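/- Let $G$ be a connected $3$-dimensional Lie group equipped with a contact form $\vartheta$ whose kernel is spanned by left-invariant vector fields $X,Y$, and let $T$ be the left-invariant Reeb field, i.e. $\vartheta(T)=1$ and $d\vartheta(T,\cdot)=0$. Let $a_3,b_3,c$ be the constants with $[X,Y]=a_3X+b_3Y+cT$. For $\epsilon>0$ let $T_\epsilon=\epsilon T$ and let $g_\epsilon$ be the Riemannian metric on $G$ for which $X,Y,T_\epsilon$ is orthonormal, with Levi-Civita connection $\nabla^\epsilon$. Let $u:G\to\mathbb R$ be a $C^2$ function whose differential is surjective at every point of the surface $\Sigma=\{u=0\}$, let $\|\nabla_Hu\|=\sqrt{(Xu)^2+(Yu)^2}$, and let $\mathcal C(\Sigma)=\{p\in\Sigma:(Xu,Yu)(p)=(0,0)\}$ be the characteristic set. Where $\|\nabla_Hu\|\neq0$, put $$l=\|\nabla_Hu\|,\quad l_\epsilon=\sqrt{(Xu)^2+(Yu)^2+(T_\epsilon u)^2},\quad \bar p=\frac{Xu}{l},\quad \bar q=\frac{Yu}{l},\quad \bar r=\frac{T_\epsilon u}{l},$$ and consider the $g_\epsilon$-orthonormal frame $$n_\Sigma=\frac{(Xu)X+(Yu)Y+(T_\epsilon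 u)T_\epsilon}{l_\epsilon},\qquad E_1=-\bar q\,X+\bar p\,Y,\qquad E_2=\frac{l}{l_\epsilon}\left(\bar r\bar p\,X+\bar r\bar q\,Y-T_\epsilon\right),$$ in which $n_\Sigma$ is the unit normal and $E_1,E_2$ are tangent to $\Sigma$. Let $\mathbf{II}^\epsilon=\big(-g_\epsilon(\nabla^\epsilon_{E_i}n_\Sigma,E_j)\big)_{i,j=1,2}$ be the second fundamental form, let $H^\epsilon_\Sigma=-\operatorname{Trace}(\mathbf{II}^\epsilon)$ be the Riemannian mean curvature, and let $K^\epsilon_\Sigma=\overline K^\epsilon(E_1,E_2)+\det(\mathbf{II}^\epsilon)$ be the Gauss curvature of $\Sigma$ given by the Gauss equation, where $\overline K^\epsilon(E_1,E_2)$ is the sectional curvature of $(G,g_\epsilon)$ on the plane spanned by $E_1,E_2$. Then at every point of $\Sigma\setminus\mathcal C(\Sigma)$ the following limits (the horizontal mean curvature $H^h_\Sigma$ and the horizontal Gauss curvature $K^h_\Sigma$) exist and are given by $$H^h_\Sigma:=\lim_{\epsilon\to0^+}H^\epsilon_\Sigma=X\left(\frac{Xu}{\|\nabla_Hu\|}\right)+Y\left(\frac{Yu}{\|\nabla_Hu\|}\right)+\frac{a_3\,Yu-b_3\,Xu}{\|\nabla_Hu\|},$$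 $$K^h_\Sigma:=\lim_{\epsilon\to0^+}K^\epsilon_\Sigma=E_1\left(c\,\frac{Tu}{\|\nabla_Hu\|}\right)-\left(c\,\frac{Tu}{\|\nabla_Hu\|}\right)^2 .$$ -/

import Mathlib

open scoped Manifold ContDiff Topology
open Filter Bundle VectorField

noncomputable section

namespace SubRiem

/-- The model space of three-dimensional manifolds. -/
abbrev E3 : Type := EuclideanSpace ℝ (Fin 3)

section Fields

variable (G : Type*) [TopologicalSpace G] [ChartedSpace E3 G]

/-- (Not necessarily continuous) vector fields on `G`. -/
abbrev VField : Type _ := (g : G) → TangentSpace (𝓡 3) g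

/-- (Not necessarily continuous) differential 1-forms on `G`. -/
abbrev OneForm : Type _ := (g : G) → (TangentSpace (𝓡 3) g →L[ℝ] ℝ)

variable {G}

/-- The derivative `V f` of the function `f` along the vector field `V`. -/
def along (V : VField G) (f : G → ℝ) : G → ℝ :=
  fun g => mvfderiv (𝓡 3) f g (V g)

/-- Exterior derivative of a 1-form evaluated on two vector fields:
`dα(V, W) = V(α(W)) - W(α(V)) - α([V, W])`. -/
def dOneForm (α : OneForm G) (V W : VField G) : G → ℝ := fun g =>
  along V (fun h => α h (W h)) g - along W (fun h => α h (V h)) g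
    - α g (mlieBracket (𝓡 3) V W g)

/-- The 3-form `α ∧ dα` evaluated on three vector fields. -/
def wedgeD (α : OneForm G) (U V W : VField G) : G → ℝ := fun g =>
  α g (U g) * dOneForm α V W g - α g (V g) * dOneForm α U W g + α g (W g) * dOneForm α U V g

end Fields

/-- The left-invariant vector field on `G` with value `v` at the identity. -/
abbrev leftInv {G : Type*} [TopologicalSpace G] [ChartedSpace E3 G] [Group G]
    (v : GroupLieAlgebra (𝓡 3) G) : VField G :=
  mulInvariantVectorField (I := 𝓡 3) v

/-- A contact sub-Riemannian structure on a three-dimensional Lie group `G`: a smooth contact form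
`ϑ`, whose kernel is spanned by two left-invariant vector fields `X`, `Y` (declared orthonormal for
the sub-Riemannian metric), together with its left-invariant Reeb field `T`. The left-invariant
fields are given by their values at the identity. -/
structure ContactSR (G : Type*) [TopologicalSpace G] [ChartedSpace E3 G] [Group G]
    [LieGroup (𝓡 3) ∞ G] where
  X : GroupLieAlgebra (𝓡 3) G
  Y : GroupLieAlgebra (𝓡 3) G
  T : GroupLieAlgebra (𝓡 3) G
  ϑ : OneForm G
  smooth : ContMDiff (𝓡 3) ((𝓡 3).prod 𝓘(ℝ, E3 →L[ℝ] ℝ)) ∞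
    (fun g => TotalSpace.mk' (E3 →L[ℝ] ℝ)
      (E := fun g : G => TangentSpace (𝓡 3) g →L[ℝ] ℝ) g (ϑ g))
  ker_eq : ∀ g, LinearMap.ker (ϑ g).toLinearMap = Submodule.span ℝ {leftInv X g, leftInv Y g}
  /-- `ϑ ∧ dϑ ≠ 0` everywhere, tested on the frame `X, Y, T`. -/
  contact : ∀ g, wedgeD ϑ (leftInv X) (leftInv Y) (leftInv T) g ≠ 0
  reeb_one : ∀ g, ϑ g (leftInv T g) = 1
  /-- `dϑ(T, ·) = 0`, tested on left-invariant vector fields. -/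
  reeb_d : ∀ (v : GroupLieAlgebra (𝓡 3) G) (g : G), dOneForm ϑ (leftInv T) (leftInv v) g = 0

namespace ContactSR

variable {G : Type*} [TopologicalSpace G] [ChartedSpace E3 G] [Group G] [LieGroup (𝓡 3) ∞ G]
  (S : ContactSR G)

/-- The left-invariant frame `(X, Y, T)`. -/
def frame (i : Fin 3) : VField G := ![leftInv S.X, leftInv S.Y, leftInv S.T] i

theorem top_le_span_frame (g : G) :
    ⊤ ≤ Submodule.span ℝ (Set.range fun i => S.frame i g) := by
  intro v _
  have hX : leftInv S.X g ∈ Submodule.span ℝ (Set.range fun i => S.frame i g) :=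
    Submodule.subset_span ⟨0, rfl⟩
  have hY : leftInv S.Y g ∈ Submodule.span ℝ (Set.range fun i => S.frame i g) :=
    Submodule.subset_span ⟨1, rfl⟩
  have hT : leftInv S.T g ∈ Submodule.span ℝ (Set.range fun i => S.frame i g) :=
    Submodule.subset_span ⟨2, rfl⟩
  have hk : v - S.ϑ g v • leftInv S.T g ∈ LinearMap.ker (S.ϑ g).toLinearMap := by
    rw [LinearMap.mem_ker]
    change S.ϑ g (v - S.ϑ g v • leftInv S.T g) = 0
    rw [map_sub, map_smul, S.reeb_one g]
    simp
  rw [S.ker_eq g] at hk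
  have hle : Submodule.span ℝ {leftInv S.X g, leftInv S.Y g} ≤
      Submodule.span ℝ (Set.range fun i => S.frame i g) := by
    rw [Submodule.span_le]
    rintro w (rfl | rfl)
    · exact hX
    · exact hY
  have := Submodule.add_mem _ (hle hk) (Submodule.smul_mem _ (S.ϑ g v) hT)
  simpa using this

/-- The basis `X_g, Y_g, T_g` of the tangent space at `g`. -/
def basisAt (g : G) : Module.Basis (Fin 3) ℝ (TangentSpace (𝓡 3) g) :=
  basisOfTopLeSpanOfCardEqFinrank (fun i => S.frame i g) (S.top_le_span_frame g) (by
    change _ = Module.finrank ℝ E3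
    simp)

/-- The coframe `ω₁, ω₂, ϑ` dual to `X, Y, T` (indexed by `0, 1, 2`). -/
def coframe (i : Fin 3) (g : G) (v : TangentSpace (𝓡 3) g) : ℝ := (S.basisAt g).repr v i

/-- The constant `a₃` in `[X, Y] = a₃ X + b₃ Y + c T`. -/
def a₃ : ℝ := S.coframe 0 1 ⁅S.X, S.Y⁆

/-- The constant `b₃` in `[X, Y] = a₃ X + b₃ Y + c T`. -/
def b₃ : ℝ := S.coframe 1 1 ⁅S.X, S.Y⁆

/-- The constant `c` in `[X, Y] = a₃ X + b₃ Y + c T`. -/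
def c : ℝ := S.coframe 2 1 ⁅S.X, S.Y⁆

/-! ### The approximating Riemannian metrics -/

/-- The frame `(X, Y, T_ε)` with `T_ε = ε T`. -/
def frameε (ε : ℝ) (i : Fin 3) : VField G :=
  ![leftInv S.X, leftInv S.Y, fun g => ε • leftInv S.T g] i

/-- The left-invariant Riemannian metric `g_ε` for which `X, Y, T_ε` is orthonormal. -/
def metric (ε : ℝ) (g : G) (v w : TangentSpace (𝓡 3) g) : ℝ :=
  S.coframe 0 g v * S.coframe 0 g w + S.coframe 1 g v * S.coframe 1 g w
    + (S.coframe 2 g v / ε) * (S.coframe 2 g w / ε)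

/-- The function `g_ε(V, W)` for two vector fields. -/
def inn (ε : ℝ) (V W : VField G) : G → ℝ := fun g => S.metric ε g (V g) (W g)

/-- The right-hand side of the Koszul formula, which is `2 g_ε(∇_V W, Z)`. -/
def koszul (ε : ℝ) (V W Z : VField G) : G → ℝ := fun g =>
  along V (S.inn ε W Z) g + along W (S.inn ε V Z) g - along Z (S.inn ε V W) g
    + S.inn ε (mlieBracket (𝓡 3) V W) Z g
    - S.inn ε (mlieBracket (𝓡 3) V Z) W g
    - S.inn ε (mlieBracket (𝓡 3) W Z) V g

/-- The Levi-Civita connection `∇_V W` of `g_ε`, expanded in the `g_ε`-orthonormal frame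
`X, Y, T_ε` with coefficients given by the Koszul formula. -/
def nabla (ε : ℝ) (V W : VField G) : VField G := fun g =>
  ∑ k, (S.koszul ε V W (S.frameε ε k) g / 2) • S.frameε ε k g

/-- The left-invariant vector field with value `v` at `p`. -/
def extend (p : G) (v : TangentSpace (𝓡 3) p) : VField G := fun g =>
  ∑ i, S.coframe i p v • S.frame i g

/-- The Riemann curvature tensor `R(v, w)z` of `g_ε` at `p`, where
`R(V, W)Z = ∇_V ∇_W Z - ∇_W ∇_V Z - ∇_{[V, W]} Z`; by tensoriality it may be computed with
the left-invariant extensions of the three tangent vectors. -/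
def curvature (ε : ℝ) (p : G) (v w z : TangentSpace (𝓡 3) p) : TangentSpace (𝓡 3) p :=
  S.nabla ε (S.extend p v) (S.nabla ε (S.extend p w) (S.extend p z)) p
    - S.nabla ε (S.extend p w) (S.nabla ε (S.extend p v) (S.extend p z)) p
    - S.nabla ε (mlieBracket (𝓡 3) (S.extend p v) (S.extend p w)) (S.extend p z) p

/-- The sectional curvature of `g_ε` of the plane spanned by `v` and `w`. -/
def sectional (ε : ℝ) (p : G) (v w : TangentSpace (𝓡 3) p) : ℝ :=
  S.metric ε p (S.curvature ε p v w w) v /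
    (S.metric ε p v v * S.metric ε p w w - S.metric ε p v w ^ 2)

/-! ### Surfaces -/

/-- `X u`. -/
def Xd (u : G → ℝ) : G → ℝ := along (leftInv S.X) u

/-- `Y u`. -/
def Yd (u : G → ℝ) : G → ℝ := along (leftInv S.Y) u

/-- `T u`. -/
def Td (u : G → ℝ) : G → ℝ := along (leftInv S.T) u

/-- `‖∇_H u‖`, the norm of the horizontal gradient `(X u, Y u)`. -/
def normH (u : G → ℝ) : G → ℝ := fun g => √(S.Xd u g ^ 2 + S.Yd u g ^ 2)

/-- `‖∇_ε u‖`, the norm of the Riemannian gradient `(X u) X + (Y u) Y + (T_ε u) T_ε`. -/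
def normε (ε : ℝ) (u : G → ℝ) : G → ℝ := fun g =>
  √(S.Xd u g ^ 2 + S.Yd u g ^ 2 + (ε * S.Td u g) ^ 2)

/-- The Riemannian unit normal `∇_ε u / ‖∇_ε u‖`. -/
def normal (ε : ℝ) (u : G → ℝ) : VField G := fun g =>
  (S.Xd u g / S.normε ε u g) • S.frameε ε 0 g + (S.Yd u g / S.normε ε u g) • S.frameε ε 1 g
    + (ε * S.Td u g / S.normε ε u g) • S.frameε ε 2 g

/-- The horizontal unit tangent field `E₁ = - (Y u / ‖∇_H u‖) X + (X u / ‖∇_H u‖) Y`. -/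
def E₁ (u : G → ℝ) : VField G := fun g =>
  (-(S.Yd u g / S.normH u g)) • leftInv S.X g + (S.Xd u g / S.normH u g) • leftInv S.Y g

/-- The second unit tangent field `E₂ = (l / l_ε) (r̄ p̄ X + r̄ q̄ Y - T_ε)`, where
`l = ‖∇_H u‖`, `l_ε = ‖∇_ε u‖`, `p̄ = X u / l`, `q̄ = Y u / l`, `r̄ = T_ε u / l`. -/
def E₂ (ε : ℝ) (u : G → ℝ) : VField G := fun g =>
  (S.normH u g / S.normε ε u g) •
    ((ε * S.Td u g / S.normH u g * (S.Xd u g / S.normH u g)) • S.frameε ε 0 g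
      + (ε * S.Td u g / S.normH u g * (S.Yd u g / S.normH u g)) • S.frameε ε 1 g
      - S.frameε ε 2 g)

/-- The second fundamental form `(-g_ε(∇_{E_i} n, E_j))_{i,j}` of the surface `u = 0` at `p`. -/
def secondFF (ε : ℝ) (u : G → ℝ) (p : G) : Matrix (Fin 2) (Fin 2) ℝ :=
  Matrix.of fun i j =>
    -S.metric ε p (S.nabla ε (![S.E₁ u, S.E₂ ε u] i) (S.normal ε u) p) (![S.E₁ u, S.E₂ ε u] j p)

/-- The Riemannian mean curvature `H^ε`, minus the trace of the second fundamental form. -/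
def meanCurv (ε : ℝ) (u : G → ℝ) (p : G) : ℝ := -(S.secondFF ε u p).trace

/-- The Gauss curvature `K^ε` of the surface, through the Gauss equation. -/
def gaussCurv (ε : ℝ) (u : G → ℝ) (p : G) : ℝ :=
  S.sectional ε p (S.E₁ u p) (S.E₂ ε u p) + (S.secondFF ε u p).det

end ContactSR

section Surfaces

variable {G : Type*} [TopologicalSpace G] [ChartedSpace E3 G]

/-- `u` is a `C²` defining function of the regular surface `u = 0`. -/
structure IsDefining (u : G → ℝ) : Prop where
  contMDiff : ContMDiff (𝓡 3) 𝓘(ℝ, ℝ) 2 u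
  surjective : ∀ p, u p = 0 → Function.Surjective (mfderiv (𝓡 3) 𝓘(ℝ, ℝ) u p)

/-- The surface `u = 0`. -/
def zeroSurface (u : G → ℝ) : Set G := {p | u p = 0}

/-- The characteristic set: the points of the surface where `∇_H u = (X u, Y u)` vanishes. -/
def ContactSR.charSet [Group G] [LieGroup (𝓡 3) ∞ G] (S : ContactSR G) (u : G → ℝ) : Set G :=
  {p | p ∈ zeroSurface u ∧ (S.Xd u p, S.Yd u p) = (0, 0)}

end Surfaces

end SubRiem

end

noncomputable section

namespace SubRiem

/-! ### Calculus of directional derivatives. -/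

section Along

variable {G : Type*} [TopologicalSpace G] [ChartedSpace E3 G] {p : G}

/-! Everything is computed in the orthonormal frame `X, Y, T_ε`. Its brackets have constant
coefficients, so the Koszul formula gives constant Christoffel symbols (`nabla_comb`, `conn_eq`).
The Reeb condition removes the `T`-component of `[X, T]` and `[Y, T]`, and Jacobi together with `c ≠
0` gives `b₂ = -a₁`. The only structure constant that blows up is `c / ε`, the `T_ε`-component of
`[X, Y]`; the others are bounded.

The coefficients of `E₁`, `E₂` and the normal are rational in `ε`, the derivatives of `u`, `l` and
`l_ε`. With `P = Xu / l`, `Q = Yu / l`, `A = l / l_ε` and `b = Tu / l_ε`, they satisfy `P² + Q² = 1`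
and `A² + ε² b² = 1`. Modulo these relations, the `(E₁, E₁)` entry of the second fundamental form is
bounded, the `(E₂, E₂)` entry is `O(ε²)`, and both off-diagonal entries are `-c / (2ε) + O(ε)`.
Hence the mean curvature has no singular part.

For the Gauss curvature, the sectional curvature is `c² / (4ε²)` plus a bounded term
(`sectional_eq`), and the product of the off-diagonal entries contributes `-c² / (4ε²)` to the
determinant. The divergences cancel exactly (`gaussCurv_eq`), but the cross terms `c / (2ε) · O(ε)`
survive and carry the second derivatives of `u`.

What remains is polynomial in `ε` and `l_ε⁻¹`, so the limit is its value at `(0, l⁻¹)`. Identifying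
that value with the stated curvatures uses `P² + Q² = 1` and, for the Gauss curvature, the
commutators of second derivatives (`along_leftInv_comm`). -/

theorem along_const (V : VField G) (a : ℝ) : along V (fun _ => a) p = 0 := by
  simp only [along, mvfderiv_const]
  rfl

theorem along_add {f h : G → ℝ} (V : VField G)
    (hf : MDifferentiableAt (𝓡 3) 𝓘(ℝ, ℝ) f p) (hh : MDifferentiableAt (𝓡 3) 𝓘(ℝ, ℝ) h p) :
    along V (fun g => f g + h g) p = along V f p + along V h p :=
  DFunLike.congr_fun (mvfderiv_add hf hh) (V p)

theorem along_mul {f h : G → ℝ} (V : VField G)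
    (hf : MDifferentiableAt (𝓡 3) 𝓘(ℝ, ℝ) f p) (hh : MDifferentiableAt (𝓡 3) 𝓘(ℝ, ℝ) h p) :
    along V (fun g => f g * h g) p = f p * along V h p + h p * along V f p :=
  DFunLike.congr_fun (mvfderiv_mul hf hh) (V p)

theorem along_comp {f : G → ℝ} {φ : ℝ → ℝ} {φ' : ℝ} (V : VField G)
    (hφ : HasDerivAt φ φ' (f p)) (hf : MDifferentiableAt (𝓡 3) 𝓘(ℝ, ℝ) f p) :
    along V (fun g => φ (f g)) p = φ' * along V f p := by
  have h1 := (hφ.hasFDerivAt.hasMFDerivAt.comp p hf.hasMFDerivAt).mfderiv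
  have h2 := DFunLike.congr_fun h1 (V p)
  refine h2.trans ?_
  change (mvfderiv (𝓡 3) f p (V p)) * φ' = _
  exact mul_comm _ _

end Along

/-! ### Linear dependence of a left-invariant field on its value at the identity. -/

section LeftInvariantLinear

variable {G : Type*} [TopologicalSpace G] [ChartedSpace E3 G] [Group G]

theorem leftInv_add_apply (v w : GroupLieAlgebra (𝓡 3) G) (g : G) :
    leftInv (v + w) g = leftInv v g + leftInv w g :=
  congrFun (mulInvariantVectorField_add v w) g

theorem leftInv_smul_apply (a : ℝ) (v : GroupLieAlgebra (𝓡 3) G) (g : G) :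
    leftInv (a • v) g = a • leftInv v g :=
  congrFun (mulInvariantVectorField_smul a v) g

theorem leftInv_sum_smul {ι : Type*} (s : Finset ι) (a : ι → ℝ)
    (v : ι → GroupLieAlgebra (𝓡 3) G) (g : G) :
    leftInv (∑ i ∈ s, a i • v i) g = ∑ i ∈ s, a i • leftInv (v i) g := by
  classical
  induction s using Finset.induction_on with
  | empty => simpa using leftInv_smul_apply 0 (0 : GroupLieAlgebra (𝓡 3) G) g
  | insert i s hi ih =>
    rw [Finset.sum_insert hi, Finset.sum_insert hi, leftInv_add_apply, leftInv_smul_apply, ih]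

theorem leftInv_one (v : GroupLieAlgebra (𝓡 3) G) : leftInv v (1 : G) = v := by
  have h : (fun g : G => 1 * g) = id := by funext g; simp
  have h2 : mfderiv (𝓡 3) (𝓡 3) (fun g : G => 1 * g) (1 : G) =
      ContinuousLinearMap.id ℝ (TangentSpace (𝓡 3) (1 : G)) := by
    rw [h]; exact mfderiv_id
  exact DFunLike.congr_fun h2 v

end LeftInvariantLinear

/-! ### Smoothness, brackets and commutators of left-invariant fields. -/

section LeftInvariant

variable {G : Type*} [TopologicalSpace G] [ChartedSpace E3 G] [Group G] [LieGroup (𝓡 3) ∞ G]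
  {p : G}

theorem lieGroup_minSmoothness (G : Type*) [TopologicalSpace G] [ChartedSpace E3 G] [Group G]
    [LieGroup (𝓡 3) ∞ G] : LieGroup (𝓡 3) (minSmoothness ℝ 3) G := by
  have : (minSmoothness ℝ 3 : WithTop ℕ∞) ≤ ∞ := by
    rw [minSmoothness_of_isRCLikeNormedField]
    exact WithTop.coe_le_coe.2 le_top
  exact LieGroup.of_le this

theorem contMDiff_leftInv (v : GroupLieAlgebra (𝓡 3) G) :
    ContMDiff (𝓡 3) (𝓡 3).tangent 2 (fun g : G => (leftInv v g : TangentBundle (𝓡 3) G)) := by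
  have := lieGroup_minSmoothness G
  exact (contMDiff_mulInvariantVectorField (I := 𝓡 3) (G := G) v).of_le
    minSmoothness_of_isRCLikeNormedField.ge

theorem mdifferentiableAt_leftInv (v : GroupLieAlgebra (𝓡 3) G) :
    MDifferentiableAt (𝓡 3) (𝓡 3).tangent
      (fun g : G => (leftInv v g : TangentBundle (𝓡 3) G)) p :=
  (contMDiff_leftInv v).mdifferentiable (by norm_num) p

theorem mlieBracket_leftInv (v w : GroupLieAlgebra (𝓡 3) G) :
    mlieBracket (𝓡 3) (leftInv v) (leftInv w) = (leftInv ⁅v, w⁆ : VField G) := by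
  have := lieGroup_minSmoothness G
  exact (mulInvariantVector_mlieBracket v w).symm

/-- The tangent map of a `C²` function is `C¹`, and the derivative along a smooth field is its fibre
component composed with that field. -/
theorem mdifferentiableAt_along_leftInv {u : G → ℝ} (hu : ContMDiff (𝓡 3) 𝓘(ℝ, ℝ) 2 u)
    (v : GroupLieAlgebra (𝓡 3) G) : MDifferentiableAt (𝓡 3) 𝓘(ℝ, ℝ) (along (leftInv v) u) p := by
  have : IsManifold (𝓡 3) 1 G := inferInstance
  have h1 : ContMDiff (𝓡 3).tangent 𝓘(ℝ, ℝ).tangent 1 (tangentMap (𝓡 3) 𝓘(ℝ, ℝ) u) :=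
    hu.contMDiff_tangentMap (by norm_num)
  have h2 := (contMDiff_snd_tangentBundle_modelSpace (n := 1) ℝ 𝓘(ℝ, ℝ)).comp
    (h1.comp ((contMDiff_leftInv v).of_le (by norm_num)))
  exact h2.mdifferentiable (by norm_num) p

theorem mlieBracket_fun_smul_leftInv {f : G → ℝ} (V : VField G)
    (hf : MDifferentiableAt (𝓡 3) 𝓘(ℝ, ℝ) f p) (w : GroupLieAlgebra (𝓡 3) G) :
    mlieBracket (𝓡 3) V (f • leftInv w) p =
      along V f p • leftInv w p + f p • mlieBracket (𝓡 3) V (leftInv w) p :=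
  mlieBracket_smul_right hf (mdifferentiableAt_leftInv w)

/-- The commutator of left-invariant derivations is the derivation along the Lie bracket. -/
theorem along_leftInv_comm {u : G → ℝ} (hu : ContMDiff (𝓡 3) 𝓘(ℝ, ℝ) 2 u)
    (v w z : GroupLieAlgebra (𝓡 3) G) (hz : leftInv z p ≠ 0) :
    along (leftInv v) (along (leftInv w) u) p - along (leftInv w) (along (leftInv v) u) p
      = along (leftInv ⁅v, w⁆) u p := by
  have hG := lieGroup_minSmoothness G
  have hM : IsManifold (𝓡 3) (minSmoothness ℝ 3) G := inferInstance
  have hu1 (g : G) : MDifferentiableAt (𝓡 3) 𝓘(ℝ, ℝ) u g := hu.mdifferentiable (by norm_num) g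
  have hsm (x : GroupLieAlgebra (𝓡 3) G) : ContMDiffAt (𝓡 3) (𝓡 3).tangent (minSmoothness ℝ 2)
      (fun g : G => (leftInv x g : TangentBundle (𝓡 3) G)) p := by
    exact (contMDiff_leftInv x p).of_le minSmoothness_of_isRCLikeNormedField.le
  -- The commutator is extracted from the Jacobi identity for `v`, `w` and the test field `u • z`:
  -- the Leibniz rule makes the second derivatives of `u` appear as coefficients of `z`.
  have huz : ContMDiffAt (𝓡 3) (𝓡 3).tangent (minSmoothness ℝ 2)
      (fun g : G => ((u • leftInv z : VField G) g : TangentBundle (𝓡 3) G)) p := by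
    exact ((hu p).smul_section (contMDiff_leftInv z p)).of_le
      minSmoothness_of_isRCLikeNormedField.le
  have single (x : GroupLieAlgebra (𝓡 3) G) : mlieBracket (𝓡 3) (leftInv x) (u • leftInv z) =
      (along (leftInv x) u • leftInv z + u • leftInv ⁅x, z⁆ : VField G) := by
    funext g
    rw [mlieBracket_fun_smul_leftInv _ (hu1 g), mlieBracket_leftInv]
    rfl
  have hd (x : GroupLieAlgebra (𝓡 3) G) := mdifferentiableAt_along_leftInv (p := p) hu x
  have double (x y : GroupLieAlgebra (𝓡 3) G) :
      mlieBracket (𝓡 3) (leftInv x) (mlieBracket (𝓡 3) (leftInv y) (u • leftInv z)) p =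
        (along (leftInv x) (along (leftInv y) u) p • leftInv z p
          + along (leftInv y) u p • leftInv ⁅x, z⁆ p)
        + (along (leftInv x) u p • leftInv ⁅y, z⁆ p + u p • leftInv ⁅x, ⁅y, z⁆⁆ p) := by
    rw [single, mlieBracket_add_right, mlieBracket_fun_smul_leftInv _ (hd y),
      mlieBracket_fun_smul_leftInv _ (hu1 p), mlieBracket_leftInv, mlieBracket_leftInv]
    · exact (hd y).smul_section (mdifferentiableAt_leftInv z)
    · exact (hu1 p).smul_section (mdifferentiableAt_leftInv _)
  have key := leibniz_identity_mlieBracket_apply (hsm v) (hsm w) huz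
  have jac := leibniz_identity_mlieBracket_apply (hsm v) (hsm w) (hsm z)
  simp only [mlieBracket_leftInv] at jac
  rw [double, double, mlieBracket_leftInv, single] at key
  simp only [Pi.add_apply, Pi.smul_apply'] at key
  -- Jacobi for `v`, `w`, `z` themselves matches the terms in which `u` is not differentiated; the
  -- first-order terms cancel by symmetry, leaving a multiple of `z`, which is nonzero at `p`.
  rw [jac] at key
  have : (along (leftInv v) (along (leftInv w) u) p - along (leftInv w) (along (leftInv v) u) p
      - along (leftInv ⁅v, w⁆) u p) • leftInv z p = 0 := by
    rw [← sub_eq_zero] at key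
    rw [← key]
    module
  have := (smul_eq_zero.1 this).resolve_right hz
  linarith

end LeftInvariant

namespace ContactSR

/-! ### Brackets and the connection in the frame `X, Y, T_ε`. -/

section Frame

variable {G : Type*} [TopologicalSpace G] [ChartedSpace E3 G] [Group G] [LieGroup (𝓡 3) ∞ G]
  (S : ContactSR G)

/-- The values `X, Y, T_ε` at the identity. -/
def frameVec (ε : ℝ) (i : Fin 3) : GroupLieAlgebra (𝓡 3) G := ![S.X, S.Y, ε • S.T] i

theorem frameε_eq_leftInv (ε : ℝ) (i : Fin 3) :
    S.frameε ε i = leftInv (S.frameVec ε i) := by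
  funext g
  fin_cases i
  · rfl
  · rfl
  · exact (leftInv_smul_apply ε S.T g).symm

/-- The coframe dual to `X, Y, T_ε`. -/
def coordε (ε : ℝ) (k : Fin 3) (g : G) : TangentSpace (𝓡 3) g →ₗ[ℝ] ℝ :=
  (![1, 1, ε⁻¹] k : ℝ) • (S.basisAt g).coord k

theorem basisAt_apply (g : G) (i : Fin 3) : S.basisAt g i = S.frame i g := by
  simp [basisAt]

theorem coframe_frame (g : G) (i j : Fin 3) :
    S.coframe i g (S.frame j g) = if j = i then 1 else 0 := by
  rw [coframe, ← basisAt_apply, Module.Basis.repr_self, Finsupp.single_apply]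

theorem frameε_eq_smul (ε : ℝ) (g : G) (i : Fin 3) :
    S.frameε ε i g = (![1, 1, ε] i : ℝ) • S.frame i g := by
  fin_cases i
  · exact (one_smul ℝ (S.frame 0 g)).symm
  · exact (one_smul ℝ (S.frame 1 g)).symm
  · rfl

theorem coordε_frameε {ε : ℝ} (hε : ε ≠ 0) (g : G) (k j : Fin 3) :
    S.coordε ε k g (S.frameε ε j g) = if j = k then 1 else 0 := by
  have h : S.coordε ε k g (S.frameε ε j g) =
      ![1, 1, ε⁻¹] k * (![1, 1, ε] j * S.coframe k g (S.frame j g)) := by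
    rw [frameε_eq_smul, coordε, LinearMap.smul_apply, map_smul, smul_eq_mul, smul_eq_mul]
    rfl
  rw [h, coframe_frame]
  fin_cases j <;> fin_cases k <;> simp [hε]

theorem sum_coordε_smul {ε : ℝ} (hε : ε ≠ 0) (g : G) (v : TangentSpace (𝓡 3) g) :
    ∑ k, S.coordε ε k g v • S.frameε ε k g = v := by
  conv_rhs => rw [← (S.basisAt g).sum_repr v]
  refine Finset.sum_congr rfl fun k _ => ?_
  rw [frameε_eq_smul, basisAt_apply, coordε, smul_smul]
  congr 1
  rw [LinearMap.smul_apply, smul_eq_mul, Module.Basis.coord_apply]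
  fin_cases k <;> simp [hε, mul_comm]

theorem metric_eq_sum (ε : ℝ) (g : G) (v w : TangentSpace (𝓡 3) g) :
    S.metric ε g v w = ∑ k, S.coordε ε k g v * S.coordε ε k g w := by
  simp only [Fin.sum_univ_three, metric, coordε, coframe, LinearMap.smul_apply,
    Module.Basis.coord_apply, smul_eq_mul]
  simp [div_eq_mul_inv, mul_comm]

/-- The frame is itself left-invariant and `leftInv` is linear, so the expansion at the identity is
valid at every point. This is what makes the structure constants constant. -/
theorem coordε_leftInv {ε : ℝ} (hε : ε ≠ 0) (k : Fin 3) (g : G)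
    (v : GroupLieAlgebra (𝓡 3) G) :
    S.coordε ε k g (leftInv v g) = S.coordε ε k 1 v := by
  have h : ∑ i, S.coordε ε i 1 v • S.frameVec ε i = v := by
    conv_rhs => rw [← S.sum_coordε_smul hε 1 v]
    refine Finset.sum_congr rfl fun i _ => ?_
    rw [frameε_eq_leftInv, leftInv_one]
  conv_lhs => rw [← h]
  rw [leftInv_sum_smul, map_sum]
  simp only [← frameε_eq_leftInv, map_smul, S.coordε_frameε hε, smul_eq_mul, mul_ite, mul_one,
    mul_zero]
  simp

/-- The structure constants of the frame `X, Y, T_ε`. -/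
def structConst (ε : ℝ) (i j k : Fin 3) : ℝ :=
  S.coordε ε k 1 ⁅S.frameVec ε i, S.frameVec ε j⁆

theorem coordε_mlieBracket_frameε {ε : ℝ} (hε : ε ≠ 0) (i j k : Fin 3) (g : G) :
    S.coordε ε k g (mlieBracket (𝓡 3) (S.frameε ε i) (S.frameε ε j) g) =
      S.structConst ε i j k := by
  rw [frameε_eq_leftInv, frameε_eq_leftInv, mlieBracket_leftInv, coordε_leftInv S hε]
  rfl

theorem structConst_swap {ε : ℝ} (hε : ε ≠ 0) (i j k : Fin 3) :
    S.structConst ε i j k = -S.structConst ε j i k := by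
  rw [← S.coordε_mlieBracket_frameε hε i j k 1, ← S.coordε_mlieBracket_frameε hε j i k 1,
    mlieBracket_swap_apply, map_neg]

/-- The vector field with coefficients `v` in the frame `X, Y, T_ε`. -/
def comb (ε : ℝ) (v : Fin 3 → G → ℝ) : VField G := fun g => ∑ i, v i g • S.frameε ε i g

theorem coordε_comb {ε : ℝ} (hε : ε ≠ 0) (v : Fin 3 → G → ℝ) (k : Fin 3) (g : G) :
    S.coordε ε k g (S.comb ε v g) = v k g := by
  rw [comb, map_sum]
  simp only [map_smul, S.coordε_frameε hε, smul_eq_mul, mul_ite, mul_one, mul_zero]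
  simp

theorem frameε_eq_comb (ε : ℝ) (k : Fin 3) :
    S.frameε ε k = S.comb ε fun i _ => if i = k then 1 else 0 := by
  funext g
  simp [comb, ite_smul]

theorem inn_comb {ε : ℝ} (hε : ε ≠ 0) (v w : Fin 3 → G → ℝ) :
    S.inn ε (S.comb ε v) (S.comb ε w) = fun g => ∑ k, v k g * w k g := by
  funext g
  rw [inn, metric_eq_sum]
  simp only [S.coordε_comb hε]

theorem inn_comb_frameε {ε : ℝ} (hε : ε ≠ 0) (v : Fin 3 → G → ℝ) (k : Fin 3) :
    S.inn ε (S.comb ε v) (S.frameε ε k) = v k := by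
  rw [frameε_eq_comb, inn_comb S hε]
  funext g
  simp

theorem inn_frameε {ε : ℝ} (hε : ε ≠ 0) (V : VField G) (k : Fin 3) (g : G) :
    S.inn ε V (S.frameε ε k) g = S.coordε ε k g (V g) := by
  rw [inn, metric_eq_sum]
  simp [S.coordε_frameε hε]

theorem inn_comb_right {ε : ℝ} (hε : ε ≠ 0) (V : VField G) (w : Fin 3 → G → ℝ) (g : G) :
    S.inn ε V (S.comb ε w) g = ∑ k, S.coordε ε k g (V g) * w k g := by
  rw [inn, metric_eq_sum]
  simp [S.coordε_comb hε]

theorem along_comb (ε : ℝ) (v : Fin 3 → G → ℝ) (f : G → ℝ) (g : G) :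
    along (S.comb ε v) f g = ∑ i, v i g * along (S.frameε ε i) f g := by
  simp [along, comb, map_sum]

variable {p : G}

theorem mlieBracket_comb_right {ε : ℝ} (V : VField G) {w : Fin 3 → G → ℝ}
    (hw : ∀ i, MDifferentiableAt (𝓡 3) 𝓘(ℝ, ℝ) (w i) p) :
    mlieBracket (𝓡 3) V (S.comb ε w) p = ∑ j, (along V (w j) p • S.frameε ε j p
      + w j p • mlieBracket (𝓡 3) V (S.frameε ε j) p) := by
  have hd (j : Fin 3) : MDifferentiableAt (𝓡 3) (𝓡 3).tangent
      (fun g : G => ((w j • leftInv (S.frameVec ε j) : VField G) g : TangentBundle (𝓡 3) G)) p :=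
    (hw j).smul_section (mdifferentiableAt_leftInv _)
  have hc : S.comb ε w = w 0 • leftInv (S.frameVec ε 0) + w 1 • leftInv (S.frameVec ε 1)
      + w 2 • leftInv (S.frameVec ε 2) := by
    funext g
    simp only [comb, Fin.sum_univ_three, frameε_eq_leftInv]
    rfl
  rw [hc, mlieBracket_add_right (mdifferentiableAt_add_section (hd 0) (hd 1)) (hd 2),
    mlieBracket_add_right (hd 0) (hd 1), mlieBracket_fun_smul_leftInv _ (hw 0),
    mlieBracket_fun_smul_leftInv _ (hw 1), mlieBracket_fun_smul_leftInv _ (hw 2)]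
  simp only [Fin.sum_univ_three, frameε_eq_leftInv]

theorem coordε_mlieBracket_comb_frameε {ε : ℝ} (hε : ε ≠ 0) {v : Fin 3 → G → ℝ}
    (hv : ∀ i, MDifferentiableAt (𝓡 3) 𝓘(ℝ, ℝ) (v i) p) (j k : Fin 3) :
    S.coordε ε k p (mlieBracket (𝓡 3) (S.comb ε v) (S.frameε ε j) p) =
      -along (S.frameε ε j) (v k) p + ∑ i, v i p * S.structConst ε i j k := by
  rw [mlieBracket_swap_apply, S.mlieBracket_comb_right _ hv]
  simp only [map_neg, map_sum, map_add, map_smul, S.coordε_frameε hε,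
    S.coordε_mlieBracket_frameε hε, smul_eq_mul, mul_ite, mul_one, mul_zero,
    Finset.sum_add_distrib, S.structConst_swap hε j]
  simp [add_comm]

theorem coordε_mlieBracket_comb {ε : ℝ} (hε : ε ≠ 0) {v w : Fin 3 → G → ℝ}
    (hv : ∀ i, MDifferentiableAt (𝓡 3) 𝓘(ℝ, ℝ) (v i) p)
    (hw : ∀ i, MDifferentiableAt (𝓡 3) 𝓘(ℝ, ℝ) (w i) p) (k : Fin 3) :
    S.coordε ε k p (mlieBracket (𝓡 3) (S.comb ε v) (S.comb ε w) p) =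
      along (S.comb ε v) (w k) p - along (S.comb ε w) (v k) p
        + ∑ j, w j p * ∑ i, v i p * S.structConst ε i j k := by
  rw [S.mlieBracket_comb_right _ hw, S.along_comb ε w]
  simp only [map_sum, map_add, map_smul, S.coordε_frameε hε,
    S.coordε_mlieBracket_comb_frameε hε hv, smul_eq_mul, mul_ite, mul_one, mul_zero,
    Finset.sum_add_distrib, mul_add, mul_neg, Finset.sum_neg_distrib]
  simp
  ring

/-- The Christoffel symbols of `g_ε` in the frame `X, Y, T_ε`. -/
def christoffel (ε : ℝ) (i j k : Fin 3) : ℝ :=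
  (S.structConst ε i j k - S.structConst ε i k j - S.structConst ε j k i) / 2

/-- The value of the connection on constant coefficients. -/
def conn (ε : ℝ) (v w : Fin 3 → ℝ) (k : Fin 3) : ℝ :=
  ∑ i, ∑ j, v i * w j * S.christoffel ε i j k

/-- In an orthonormal frame the Koszul terms differentiating along `S.frameε ε k` cancel against
those from the brackets with that field. The `w`-derivatives of `v` cancel too, so twice the
derivative of `w k` and the Christoffel terms are left. -/
theorem nabla_comb {ε : ℝ} (hε : ε ≠ 0) {v w : Fin 3 → G → ℝ}
    (hv : ∀ i, MDifferentiableAt (𝓡 3) 𝓘(ℝ, ℝ) (v i) p)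
    (hw : ∀ i, MDifferentiableAt (𝓡 3) 𝓘(ℝ, ℝ) (w i) p) :
    S.nabla ε (S.comb ε v) (S.comb ε w) p =
      ∑ k, (along (S.comb ε v) (w k) p + S.conn ε (fun i => v i p) (fun i => w i p) k)
        • S.frameε ε k p := by
  refine Finset.sum_congr rfl fun k _ => ?_
  congr 1
  have hvw : along (S.frameε ε k) (fun g => ∑ i, v i g * w i g) p =
      ∑ i, (v i p * along (S.frameε ε k) (w i) p + w i p * along (S.frameε ε k) (v i) p) := by
    have hm (i : Fin 3) : MDifferentiableAt (𝓡 3) 𝓘(ℝ, ℝ) (fun g => v i g * w i g) p :=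
      (hv i).mul (hw i)
    have hm2 : MDifferentiableAt (𝓡 3) 𝓘(ℝ, ℝ) (fun g => v 0 g * w 0 g + v 1 g * w 1 g) p :=
      (hm 0).add (hm 1)
    simp only [Fin.sum_univ_three]
    rw [along_add _ hm2 (hm 2), along_add _ (hm 0) (hm 1), along_mul _ (hv 0) (hw 0),
      along_mul _ (hv 1) (hw 1), along_mul _ (hv 2) (hw 2)]
  rw [koszul, S.inn_comb_frameε hε, S.inn_comb_frameε hε, S.inn_comb hε, hvw,
    S.inn_frameε hε, S.inn_comb_right hε, S.inn_comb_right hε,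
    S.coordε_mlieBracket_comb hε hv hw]
  simp only [S.coordε_mlieBracket_comb_frameε hε hv, S.coordε_mlieBracket_comb_frameε hε hw,
    conn, christoffel, Fin.sum_univ_three]
  ring

end Frame

/-! ### Contact and Reeb conditions on the structure constants. -/

section StructureConstants

variable {G : Type*} [TopologicalSpace G] [ChartedSpace E3 G] [Group G] [LieGroup (𝓡 3) ∞ G]
  (S : ContactSR G)

theorem ϑ_X (g : G) : S.ϑ g (leftInv S.X g) = 0 := by
  have : leftInv S.X g ∈ LinearMap.ker (S.ϑ g).toLinearMap := by
    rw [S.ker_eq]; exact Submodule.subset_span (by simp)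
  exact this

theorem ϑ_Y (g : G) : S.ϑ g (leftInv S.Y g) = 0 := by
  have : leftInv S.Y g ∈ LinearMap.ker (S.ϑ g).toLinearMap := by
    rw [S.ker_eq]; exact Submodule.subset_span (by simp)
  exact this

theorem sum_coframe_smul (v : GroupLieAlgebra (𝓡 3) G) :
    v = S.coframe 0 1 v • S.X + S.coframe 1 1 v • S.Y + S.coframe 2 1 v • S.T := by
  have h := (S.basisAt 1).sum_repr v
  simp only [Fin.sum_univ_three, basisAt_apply] at h
  have h0 : S.frame 0 (1 : G) = S.X := leftInv_one S.X
  have h1 : S.frame 1 (1 : G) = S.Y := leftInv_one S.Y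
  have h2 : S.frame 2 (1 : G) = S.T := leftInv_one S.T
  rw [h0, h1, h2] at h
  exact h.symm

/-- `ϑ` vanishes on `X` and `Y` and equals `1` on `T`, so it is the third dual covector. -/
theorem coframe_two (v : GroupLieAlgebra (𝓡 3) G) : S.coframe 2 1 v = S.ϑ 1 v := by
  conv_rhs => rw [S.sum_coframe_smul v]
  have h0 : S.ϑ 1 S.X = 0 := by have := S.ϑ_X 1; rwa [leftInv_one] at this
  have h1 : S.ϑ 1 S.Y = 0 := by have := S.ϑ_Y 1; rwa [leftInv_one] at this
  have h2 : S.ϑ 1 S.T = 1 := by have := S.reeb_one 1; rwa [leftInv_one] at this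
  have : S.ϑ 1 (S.coframe 0 1 v • S.X + S.coframe 1 1 v • S.Y + S.coframe 2 1 v • S.T) =
      S.coframe 0 1 v * S.ϑ 1 S.X + S.coframe 1 1 v * S.ϑ 1 S.Y
        + S.coframe 2 1 v * S.ϑ 1 S.T := by
    erw [map_add, map_add, map_smul, map_smul, map_smul]
    rfl
  rw [this, h0, h1, h2]
  ring

/-- Since `ϑ(v)` and `ϑ(T)` are constant, `dϑ(T, v)` reduces to `-ϑ([T, v])`, and the Reeb condition
makes it vanish. -/
theorem ϑ_lie_T {v : GroupLieAlgebra (𝓡 3) G} (hv : ∀ g, S.ϑ g (leftInv v g) = 0) :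
    S.coframe 2 1 ⁅v, S.T⁆ = 0 := by
  have h := S.reeb_d v 1
  simp only [dOneForm, hv, S.reeb_one, along_const] at h
  rw [mlieBracket_swap_apply] at h
  rw [coframe_two]
  have h2 : S.ϑ 1 (-mlieBracket (𝓡 3) (leftInv v) (leftInv S.T) 1) =
    -S.ϑ 1 ⁅v, S.T⁆ := map_neg (S.ϑ 1) _
  rw [h2] at h
  linarith

/-- On `X, Y, T` the contact form `ϑ ∧ dϑ` reduces to `dϑ(X, Y) = -c`. -/
theorem c_ne_zero : S.c ≠ 0 := by
  have h := S.contact 1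
  simp only [wedgeD, S.ϑ_X, S.ϑ_Y, S.reeb_one, dOneForm, along_const] at h
  intro hc
  rw [c, coframe_two] at hc
  apply h
  have h2 : S.ϑ 1 (mlieBracket (𝓡 3) (leftInv S.X) (leftInv S.Y) 1) = 0 := hc
  rw [h2]
  ring

/-- The `X`-component of `[X, T]`. -/
def a₁ : ℝ := S.coframe 0 1 ⁅S.X, S.T⁆

/-- The `Y`-component of `[X, T]`. -/
def b₁ : ℝ := S.coframe 1 1 ⁅S.X, S.T⁆

/-- The `X`-component of `[Y, T]`. -/
def a₂ : ℝ := S.coframe 0 1 ⁅S.Y, S.T⁆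

/-- The `Y`-component of `[Y, T]`. -/
def b₂ : ℝ := S.coframe 1 1 ⁅S.Y, S.T⁆

theorem lie_X_Y : ⁅S.X, S.Y⁆ = S.a₃ • S.X + S.b₃ • S.Y + S.c • S.T :=
  S.sum_coframe_smul _

theorem lie_X_T : ⁅S.X, S.T⁆ = S.a₁ • S.X + S.b₁ • S.Y := by
  have h := S.sum_coframe_smul ⁅S.X, S.T⁆
  rw [S.ϑ_lie_T S.ϑ_X, zero_smul, add_zero] at h
  exact h

theorem lie_Y_T : ⁅S.Y, S.T⁆ = S.a₂ • S.X + S.b₂ • S.Y := by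
  have h := S.sum_coframe_smul ⁅S.Y, S.T⁆
  rw [S.ϑ_lie_T S.ϑ_Y, zero_smul, add_zero] at h
  exact h

theorem coframe_add (k : Fin 3) (v w : GroupLieAlgebra (𝓡 3) G) :
    S.coframe k 1 (v + w) = S.coframe k 1 v + S.coframe k 1 w :=
  map_add ((S.basisAt 1).coord k) v w

theorem coframe_smul (k : Fin 3) (a : ℝ) (v : GroupLieAlgebra (𝓡 3) G) :
    S.coframe k 1 (a • v) = a * S.coframe k 1 v :=
  map_smul ((S.basisAt 1).coord k) a v

theorem coframe_neg (k : Fin 3) (v : GroupLieAlgebra (𝓡 3) G) :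
    S.coframe k 1 (-v) = -S.coframe k 1 v :=
  map_neg ((S.basisAt 1).coord k) v

/-- The group is unimodular: `ad T` is trace free. -/
theorem b₂_eq : S.b₂ = -S.a₁ := by
  have hG := lieGroup_minSmoothness G
  have jac := lie_jacobi S.X S.Y S.T
  rw [S.lie_Y_T, S.lie_X_Y, ← lie_skew S.T S.X, S.lie_X_T] at jac
  simp only [lie_add, lie_smul, lie_neg, lie_self, smul_zero, zero_add, add_zero] at jac
  rw [← lie_skew S.Y S.X, ← lie_skew S.T S.X, ← lie_skew S.T S.Y, S.lie_X_T, S.lie_Y_T] at jac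
  have hX : ⁅S.X, S.Y⁆ = S.c • S.T + (S.a₃ • S.X + S.b₃ • S.Y) := by
    rw [S.lie_X_Y]; abel
  have hT : S.coframe 2 1 S.T = 1 := by
    rw [coframe_two]; have := S.reeb_one 1; rwa [leftInv_one] at this
  have hx : S.coframe 2 1 S.X = 0 := by
    rw [coframe_two]; have := S.ϑ_X 1; rwa [leftInv_one] at this
  have hy : S.coframe 2 1 S.Y = 0 := by
    rw [coframe_two]; have := S.ϑ_Y 1; rwa [leftInv_one] at this
  rw [hX] at jac
  -- Only the `T`-component of the Jacobi identity is needed: it reads `c (a₁ + b₂) = 0`.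
  have key := congrArg (S.coframe 2 1) jac
  have h0 : S.coframe 2 1 (0 : GroupLieAlgebra (𝓡 3) G) = 0 :=
    map_zero ((S.basisAt 1).coord 2)
  simp only [coframe_add, coframe_smul, coframe_neg, hT, hx, hy,
    h0] at key
  have : S.c * (S.b₂ + S.a₁) = 0 := by linarith
  linarith [(mul_eq_zero.1 this).resolve_left S.c_ne_zero]

theorem structConst_self {ε : ℝ} (hε : ε ≠ 0) (i k : Fin 3) : S.structConst ε i i k = 0 := by
  linarith [S.structConst_swap hε i i k]

theorem coordε_one (ε : ℝ) (k : Fin 3) (v : GroupLieAlgebra (𝓡 3) G) :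
    S.coordε ε k 1 v = ![1, 1, ε⁻¹] k * S.coframe k 1 v := rfl

/-- Since `T = ε⁻¹ T_ε`, the third entry is `c / ε`, the source of every singular term below. -/
theorem structConst_zero_one (ε : ℝ) (k : Fin 3) :
    S.structConst ε 0 1 k = ![S.a₃, S.b₃, S.c / ε] k := by
  rw [structConst, coordε_one]
  fin_cases k
  · exact one_mul _
  · exact one_mul _
  · exact (div_eq_inv_mul _ _).symm

theorem structConst_zero_two {ε : ℝ} (k : Fin 3) :
    S.structConst ε 0 2 k = ![ε * S.a₁, ε * S.b₁, 0] k := by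
  have hG := lieGroup_minSmoothness G
  have h : ⁅S.frameVec ε 0, S.frameVec ε 2⁆ = ε • ⁅S.X, S.T⁆ := lie_smul ε S.X S.T
  rw [structConst, coordε_one, h, coframe_smul]
  fin_cases k
  · exact one_mul _
  · exact one_mul _
  · simp [S.ϑ_lie_T S.ϑ_X]

theorem structConst_one_two {ε : ℝ} (k : Fin 3) :
    S.structConst ε 1 2 k = ![ε * S.a₂, ε * S.b₂, 0] k := by
  have hG := lieGroup_minSmoothness G
  have h : ⁅S.frameVec ε 1, S.frameVec ε 2⁆ = ε • ⁅S.Y, S.T⁆ := lie_smul ε S.Y S.T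
  rw [structConst, coordε_one, h, coframe_smul]
  fin_cases k
  · exact one_mul _
  · exact one_mul _
  · simp [S.ϑ_lie_T S.ϑ_Y]

/-- The connection on constant coefficients, in terms of the brackets of `X, Y, T`. -/
theorem conn_eq {ε : ℝ} (hε : ε ≠ 0) (v w : Fin 3 → ℝ) :
    S.conn ε v w = ![
      v 0 * (S.a₃ * w 1 + ε * S.a₁ * w 2)
        + v 1 * (S.b₃ * w 1 + (S.c / ε + ε * (S.b₁ + S.a₂)) / 2 * w 2)
        + v 2 * (S.c / ε + ε * (S.b₁ - S.a₂)) / 2 * w 1,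
      v 0 * (-S.a₃ * w 0 - (S.c / ε - ε * (S.b₁ + S.a₂)) / 2 * w 2)
        - v 1 * (S.b₃ * w 0 - ε * S.b₂ * w 2)
        - v 2 * (S.c / ε + ε * (S.b₁ - S.a₂)) / 2 * w 0,
      v 0 * (-ε * S.a₁ * w 0 + (S.c / ε - ε * (S.b₁ + S.a₂)) / 2 * w 1)
        - v 1 * ((S.c / ε + ε * (S.b₁ + S.a₂)) / 2 * w 0 + ε * S.b₂ * w 1)] := by
  have h10 := S.structConst_swap hε 1 0
  have h20 := S.structConst_swap hε 2 0
  have h21 := S.structConst_swap hε 2 1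
  funext k
  simp only [conn, christoffel, Fin.sum_univ_three, h10, h20, h21]
  fin_cases k <;>
  · simp [S.structConst_self hε, h10, h20, h21, structConst_zero_one, structConst_zero_two,
      structConst_one_two]
    ring

end StructureConstants

/-! ### Sectional curvature of the approximating metrics. -/

section Curvature

variable {G : Type*} [TopologicalSpace G] [ChartedSpace E3 G] [Group G] [LieGroup (𝓡 3) ∞ G]
  (S : ContactSR G)

theorem extend_eq_comb {ε : ℝ} (hε : ε ≠ 0) (p : G) (v : TangentSpace (𝓡 3) p) :
    S.extend p v = S.comb ε fun i _ => S.coordε ε i p v := by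
  funext g
  refine Finset.sum_congr rfl fun i _ => ?_
  change _ = S.coordε ε i p v • S.frameε ε i g
  rw [frameε_eq_smul, smul_smul, coordε, LinearMap.smul_apply, Module.Basis.coord_apply, coframe,
    smul_eq_mul]
  congr 1
  fin_cases i <;> simp [hε, mul_comm]

theorem nabla_comb_const {ε : ℝ} (hε : ε ≠ 0) (v w : Fin 3 → ℝ) :
    S.nabla ε (S.comb ε fun i _ => v i) (S.comb ε fun i _ => w i) =
      S.comb ε fun i _ => S.conn ε v w i := by
  funext g
  rw [S.nabla_comb hε (fun _ => mdifferentiableAt_const) (fun _ => mdifferentiableAt_const)]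
  simp only [along_const, zero_add, comb]

/-- The Lie bracket on constant coefficients. -/
def lieCoeff (ε : ℝ) (v w : Fin 3 → ℝ) (k : Fin 3) : ℝ :=
  ∑ j, w j * ∑ i, v i * S.structConst ε i j k

theorem mlieBracket_comb_const {ε : ℝ} (hε : ε ≠ 0) (v w : Fin 3 → ℝ) :
    mlieBracket (𝓡 3) (S.comb ε fun i (_ : G) => v i) (S.comb ε fun i _ => w i) =
      S.comb ε fun i _ => S.lieCoeff ε v w i := by
  funext g
  rw [← S.sum_coordε_smul hε g (mlieBracket (𝓡 3) _ _ g)]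
  refine Finset.sum_congr rfl fun k _ => ?_
  rw [S.coordε_mlieBracket_comb hε (fun _ => mdifferentiableAt_const)
    (fun _ => mdifferentiableAt_const), along_const, along_const, sub_zero, zero_add]
  rfl

/-- Left-invariant extensions have constant coefficients, and so do their covariant derivatives and
brackets; the curvature is therefore algebraic in `conn` and `lieCoeff`. -/
theorem coordε_curvature {ε : ℝ} (hε : ε ≠ 0) (p : G) (v w z : TangentSpace (𝓡 3) p)
    (k : Fin 3) :
    S.coordε ε k p (S.curvature ε p v w z) =
      S.conn ε (fun i => S.coordε ε i p v)
          (S.conn ε (fun i => S.coordε ε i p w) fun i => S.coordε ε i p z) k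
        - S.conn ε (fun i => S.coordε ε i p w)
          (S.conn ε (fun i => S.coordε ε i p v) fun i => S.coordε ε i p z) k
        - S.conn ε (S.lieCoeff ε (fun i => S.coordε ε i p v) fun i => S.coordε ε i p w)
          (fun i => S.coordε ε i p z) k := by
  rw [curvature, S.extend_eq_comb hε, S.extend_eq_comb hε, S.extend_eq_comb hε,
    S.mlieBracket_comb_const hε, S.nabla_comb_const hε, S.nabla_comb_const hε,
    S.nabla_comb_const hε, S.nabla_comb_const hε, S.nabla_comb_const hε, map_sub, map_sub,
    S.coordε_comb hε, S.coordε_comb hε, S.coordε_comb hε]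

theorem lieCoeff_eq {ε : ℝ} (hε : ε ≠ 0) (v w : Fin 3 → ℝ) :
    S.lieCoeff ε v w = ![
      S.a₃ * (v 0 * w 1 - v 1 * w 0) + ε * S.a₁ * (v 0 * w 2 - v 2 * w 0)
        + ε * S.a₂ * (v 1 * w 2 - v 2 * w 1),
      S.b₃ * (v 0 * w 1 - v 1 * w 0) + ε * S.b₁ * (v 0 * w 2 - v 2 * w 0)
        + ε * S.b₂ * (v 1 * w 2 - v 2 * w 1),
      S.c / ε * (v 0 * w 1 - v 1 * w 0)] := by
  have h10 := S.structConst_swap hε 1 0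
  have h20 := S.structConst_swap hε 2 0
  have h21 := S.structConst_swap hε 2 1
  funext k
  simp only [lieCoeff, Fin.sum_univ_three, h10, h20, h21, S.structConst_self hε,
    structConst_zero_one, structConst_zero_two, structConst_one_two]
  fin_cases k <;> simp <;> ring

/-- The part of the sectional curvature of the plane with `g_ε`-unit normal
`A (p X + q Y) + ε b T_ε` that stays bounded as `ε → 0`. -/
def sectionalRest (p q A b ε : ℝ) : ℝ :=
  -(b ^ 2 * S.c ^ 2) + S.c * ((S.a₂ + S.b₁) * (1 - 2 * q ^ 2) / 2 - 2 * S.a₁ * p * q)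
    + ε ^ 2 * (A * b * (3 * S.a₁ * (S.a₃ * q + S.b₃ * p) - 2 * S.a₂ * S.a₃ * p
          + S.a₂ * S.b₃ * q - S.a₃ * S.b₁ * p + 2 * S.b₁ * S.b₃ * q)
      + ε ^ 2 * b ^ 2 * (2 * S.a₁ * (S.b₁ - S.a₂) * p * q + 2 * S.a₁ ^ 2 + S.a₂ * S.b₁
          + S.a₂ ^ 2 * (1 - q ^ 2) + S.b₁ ^ 2 * q ^ 2)
      + S.c * b ^ 2 * (2 * S.a₁ * p * q + S.a₂ * q ^ 2 - S.b₁ * (1 - q ^ 2))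
      + (2 * S.a₁ * (S.a₂ - S.b₁) * p * q - S.a₁ ^ 2 - S.a₂ * S.b₁ / 2 - 3 / 4 * S.a₂ ^ 2
          + S.a₂ ^ 2 * q ^ 2 - (S.a₃ ^ 2 + S.b₃ ^ 2) * b ^ 2 + S.b₁ ^ 2 / 4
          - S.b₁ ^ 2 * q ^ 2))

/-- This isolates the divergence `c² / (4ε²)`, which is the same for all such planes; their tilt
enters only through `sectionalRest`. -/
theorem sectional_eq {ε : ℝ} (hε : ε ≠ 0) {x : G} {v w : TangentSpace (𝓡 3) x} {p q A b : ℝ}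
    (hpq : p ^ 2 + q ^ 2 = 1) (hA : A ^ 2 + ε ^ 2 * b ^ 2 = 1)
    (hv : (fun i => S.coordε ε i x v) = ![-q, p, 0])
    (hw : (fun i => S.coordε ε i x w) = ![ε * b * p, ε * b * q, -A]) :
    S.sectional ε x v w = S.c ^ 2 / (4 * ε ^ 2) + S.sectionalRest p q A b ε := by
  have hvi (i : Fin 3) : S.coordε ε i x v = ![-q, p, 0] i := congrFun hv i
  have hwi (i : Fin 3) : S.coordε ε i x w = ![ε * b * p, ε * b * q, -A] i := congrFun hw i
  have hden : S.metric ε x v v * S.metric ε x w w - S.metric ε x v w ^ 2 = 1 := by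
    simp only [metric_eq_sum, hvi, hwi, Fin.sum_univ_three]
    simp
    linear_combination (A ^ 2 + ε ^ 2 * b ^ 2 * (p ^ 2 + q ^ 2 + 1)) * hpq + hA
  have hb := S.b₂_eq
  -- Writing `c = κ ε` removes all denominators, so the claim becomes a polynomial identity modulo
  -- `hA` and `hpq`; the long coefficients below are the cofactors of these two relations.
  obtain ⟨κ, hκ⟩ : ∃ κ, κ = S.c / ε := ⟨_, rfl⟩
  have hc : S.c = κ * ε := by rw [hκ]; field_simp
  have hc2 : S.c ^ 2 / (4 * ε ^ 2) = κ ^ 2 / 4 := by rw [hc]; field_simp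
  rw [sectional, hden, div_one, metric_eq_sum, hc2, sectionalRest]
  simp only [S.coordε_curvature hε, hw, hvi, Fin.sum_univ_three]
  simp only [S.conn_eq hε, S.lieCoeff_eq hε, ← hκ, hb]
  rw [hc]
  generalize S.a₁ = a1, S.b₁ = b1, S.a₂ = a2, S.a₃ = a3, S.b₃ = b3
  simp only [Fin.isValue, Matrix.cons_val_zero, Matrix.cons_val_one, Matrix.cons_val]
  linear_combination (2 * a1 * a2 * ε ^ 2 * p * q - 2 * a1 * b1 * ε ^ 2 * p * q - 2 * a1 * ε * κ * p * q - a1 ^ 2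
      * ε ^ 2 * p ^ 2 - a1 ^ 2 * ε ^ 2 * q ^ 2 - 1/2 * a2 * b1 * ε ^ 2 * p ^ 2 - 1/2 * a2 * b1 *
      ε ^ 2 * q ^ 2 + 1/2 * a2 * ε * κ * p ^ 2 - 1/2 * a2 * ε * κ * q ^ 2 - 3/4 * a2 ^ 2 * ε ^ 2
      * p ^ 2 + 1/4 * a2 ^ 2 * ε ^ 2 * q ^ 2 + 1/2 * b1 * ε * κ * p ^ 2 - 1/2 * b1 * ε * κ * q ^
      2 + 1/4 * b1 ^ 2 * ε ^ 2 * p ^ 2 - 3/4 * b1 ^ 2 * ε ^ 2 * q ^ 2 + 1/4 * κ ^ 2 * p ^ 2 + 1/4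
      * κ ^ 2 * q ^ 2) * hA + (3 * A * a1 * a3 * b * ε ^ 2 * q + 3 * A * a1 * b * b3 * ε ^ 2 * p - 2 * A * a2 * a3 * b * ε
      ^ 2 * p + A * a2 * b * b3 * ε ^ 2 * q - A * a3 * b * b1 * ε ^ 2 * p + 2 * A * b * b1 * b3 *
      ε ^ 2 * q + 2 * a1 ^ 2 * b ^ 2 * ε ^ 4 + a1 ^ 2 * b ^ 2 * ε ^ 4 * p ^ 2 + a1 ^ 2 * b ^ 2 *
      ε ^ 4 * q ^ 2 - a1 ^ 2 * ε ^ 2 + a2 * b ^ 2 * b1 * ε ^ 4 + 1/2 * a2 * b ^ 2 * b1 * ε ^ 4 *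
      p ^ 2 + 1/2 * a2 * b ^ 2 * b1 * ε ^ 4 * q ^ 2 + 1/2 * a2 * b ^ 2 * ε ^ 3 * κ * p ^ 2 + 1/2
      * a2 * b ^ 2 * ε ^ 3 * κ * q ^ 2 - 1/2 * a2 * b1 * ε ^ 2 + 1/2 * a2 * ε * κ + a2 ^ 2 * b ^
      2 * ε ^ 4 + 1/4 * a2 ^ 2 * b ^ 2 * ε ^ 4 * p ^ 2 + 1/4 * a2 ^ 2 * b ^ 2 * ε ^ 4 * q ^ 2 -
      3/4 * a2 ^ 2 * ε ^ 2 - a3 ^ 2 * b ^ 2 * ε ^ 2 - a3 ^ 2 * b ^ 2 * ε ^ 2 * p ^ 2 - a3 ^ 2 * b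
      ^ 2 * ε ^ 2 * q ^ 2 - b ^ 2 * b1 * ε ^ 3 * κ - 1/2 * b ^ 2 * b1 * ε ^ 3 * κ * p ^ 2 - 1/2 *
      b ^ 2 * b1 * ε ^ 3 * κ * q ^ 2 + 1/4 * b ^ 2 * b1 ^ 2 * ε ^ 4 * p ^ 2 + 1/4 * b ^ 2 * b1 ^
      2 * ε ^ 4 * q ^ 2 - b ^ 2 * b3 ^ 2 * ε ^ 2 - b ^ 2 * b3 ^ 2 * ε ^ 2 * p ^ 2 - b ^ 2 * b3 ^
      2 * ε ^ 2 * q ^ 2 - b ^ 2 * ε ^ 2 * κ ^ 2 - 3/4 * b ^ 2 * ε ^ 2 * κ ^ 2 * p ^ 2 - 3/4 * b ^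
      2 * ε ^ 2 * κ ^ 2 * q ^ 2 + 1/2 * b1 * ε * κ + 1/4 * b1 ^ 2 * ε ^ 2 + 1/4 * κ ^ 2) * hpq

end Curvature

/-! ### The adapted frame of the surface and derivatives of the normal. -/

section SurfaceFields

variable {G : Type*} [TopologicalSpace G] [ChartedSpace E3 G] [Group G] [LieGroup (𝓡 3) ∞ G]
  (S : ContactSR G) {u : G → ℝ} {p : G}

/-- The coefficients `X u, Y u, T_ε u` of the Riemannian gradient. -/
def gradCoeff (ε : ℝ) (u : G → ℝ) (k : Fin 3) (g : G) : ℝ :=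
  ![S.Xd u g, S.Yd u g, ε * S.Td u g] k

/-- The coefficients of `E₁`. -/
def E₁Coeff (u : G → ℝ) (k : Fin 3) (g : G) : ℝ :=
  ![-(S.Yd u g / S.normH u g), S.Xd u g / S.normH u g, 0] k

/-- The coefficients of `E₂`. -/
def E₂Coeff (ε : ℝ) (u : G → ℝ) (k : Fin 3) (g : G) : ℝ :=
  S.normH u g / S.normε ε u g * ![ε * S.Td u g / S.normH u g * (S.Xd u g / S.normH u g),
    ε * S.Td u g / S.normH u g * (S.Yd u g / S.normH u g), -1] k

theorem E₁_eq_comb (ε : ℝ) (u : G → ℝ) : S.E₁ u = S.comb ε (S.E₁Coeff u) := by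
  funext g
  rw [comb, Fin.sum_univ_three]
  change S.E₁ u g = S.E₁ u g + (0 : ℝ) • S.frameε ε 2 g
  rw [zero_smul, add_zero]

theorem E₂_eq_comb (ε : ℝ) (u : G → ℝ) : S.E₂ ε u = S.comb ε (S.E₂Coeff ε u) := by
  funext g
  rw [comb, Fin.sum_univ_three, E₂]
  simp only [E₂Coeff, mul_smul (S.normH u g / S.normε ε u g), ← smul_add]
  congr 1
  change _ = _ + _ + (-1 : ℝ) • S.frameε ε 2 g
  rw [neg_one_smul, ← sub_eq_add_neg]
  rfl

theorem normal_eq_comb (ε : ℝ) (u : G → ℝ) :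
    S.normal ε u = S.comb ε fun k g => S.gradCoeff ε u k g * (S.normε ε u g)⁻¹ := by
  funext g
  rw [comb, Fin.sum_univ_three]
  rfl

/-- The second derivatives of `u` along the frame `X, Y, T`. -/
def frameHess (u : G → ℝ) (p : G) (i k : Fin 3) : ℝ :=
  along (S.frame i) (along (S.frame k) u) p

theorem mdifferentiableAt_Xd (hu : ContMDiff (𝓡 3) 𝓘(ℝ, ℝ) 2 u) :
    MDifferentiableAt (𝓡 3) 𝓘(ℝ, ℝ) (S.Xd u) p :=
  mdifferentiableAt_along_leftInv hu _

theorem mdifferentiableAt_Yd (hu : ContMDiff (𝓡 3) 𝓘(ℝ, ℝ) 2 u) :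
    MDifferentiableAt (𝓡 3) 𝓘(ℝ, ℝ) (S.Yd u) p :=
  mdifferentiableAt_along_leftInv hu _

theorem mdifferentiableAt_Td (hu : ContMDiff (𝓡 3) 𝓘(ℝ, ℝ) 2 u) :
    MDifferentiableAt (𝓡 3) 𝓘(ℝ, ℝ) (S.Td u) p :=
  mdifferentiableAt_along_leftInv hu _

theorem mdifferentiableAt_gradCoeff (hu : ContMDiff (𝓡 3) 𝓘(ℝ, ℝ) 2 u) (ε : ℝ) (k : Fin 3) :
    MDifferentiableAt (𝓡 3) 𝓘(ℝ, ℝ) (S.gradCoeff ε u k) p := by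
  fin_cases k
  · exact S.mdifferentiableAt_Xd hu
  · exact S.mdifferentiableAt_Yd hu
  · exact mdifferentiableAt_const.mul (S.mdifferentiableAt_Td hu)

theorem along_frameε (ε : ℝ) (i : Fin 3) (f : G → ℝ) :
    along (S.frameε ε i) f p = ![1, 1, ε] i * along (S.frame i) f p := by
  rw [along, frameε_eq_smul, map_smul, smul_eq_mul, along]

theorem along_frameε_gradCoeff (hu : ContMDiff (𝓡 3) 𝓘(ℝ, ℝ) 2 u) (ε : ℝ) (i k : Fin 3) :
    along (S.frameε ε i) (S.gradCoeff ε u k) p =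
      ![1, 1, ε] i * (![1, 1, ε] k * S.frameHess u p i k) := by
  rw [along_frameε]
  congr 1
  fin_cases k
  · exact (one_mul _).symm
  · exact (one_mul _).symm
  · refine (along_mul (S.frame i) mdifferentiableAt_const (S.mdifferentiableAt_Td hu)).trans ?_
    rw [along_const, mul_zero, add_zero]
    rfl

theorem mdifferentiableAt_normε (hu : ContMDiff (𝓡 3) 𝓘(ℝ, ℝ) 2 u) {ε : ℝ}
    (h : S.Xd u p ^ 2 + S.Yd u p ^ 2 + (ε * S.Td u p) ^ 2 ≠ 0) :
    MDifferentiableAt (𝓡 3) 𝓘(ℝ, ℝ) (S.normε ε u) p := by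
  have hx := S.mdifferentiableAt_gradCoeff (p := p) hu ε
  have hq : MDifferentiableAt (𝓡 3) 𝓘(ℝ, ℝ)
      (fun g => S.Xd u g ^ 2 + S.Yd u g ^ 2 + (ε * S.Td u g) ^ 2) p :=
    (((hx 0).pow 2).add ((hx 1).pow 2)).add ((hx 2).pow 2)
  exact DifferentiableAt.comp_mdifferentiableAt
    (f := fun g => S.Xd u g ^ 2 + S.Yd u g ^ 2 + (ε * S.Td u g) ^ 2)
    (Real.hasDerivAt_sqrt h).differentiableAt hq

theorem normH_eq_normε (u : G → ℝ) : S.normH u = S.normε 0 u := by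
  funext g
  simp [normH, normε]

theorem mdifferentiableAt_normH (hu : ContMDiff (𝓡 3) 𝓘(ℝ, ℝ) 2 u)
    (h : S.Xd u p ^ 2 + S.Yd u p ^ 2 ≠ 0) :
    MDifferentiableAt (𝓡 3) 𝓘(ℝ, ℝ) (S.normH u) p := by
  rw [normH_eq_normε]
  exact S.mdifferentiableAt_normε hu (by simpa using h)

theorem normH_sq (u : G → ℝ) (p : G) : S.normH u p ^ 2 = S.Xd u p ^ 2 + S.Yd u p ^ 2 :=
  Real.sq_sqrt (by positivity)

theorem normε_sq (ε : ℝ) (u : G → ℝ) (p : G) :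
    S.normε ε u p ^ 2 = S.Xd u p ^ 2 + S.Yd u p ^ 2 + (ε * S.Td u p) ^ 2 :=
  Real.sq_sqrt (by positivity)

theorem normH_pos (h : S.Xd u p ^ 2 + S.Yd u p ^ 2 ≠ 0) : 0 < S.normH u p :=
  Real.sqrt_pos.2 (lt_of_le_of_ne (by positivity) h.symm)

theorem grad_sq_ne_zero (h : S.Xd u p ^ 2 + S.Yd u p ^ 2 ≠ 0) (ε : ℝ) :
    S.Xd u p ^ 2 + S.Yd u p ^ 2 + (ε * S.Td u p) ^ 2 ≠ 0 := by
  have : 0 < S.Xd u p ^ 2 + S.Yd u p ^ 2 := lt_of_le_of_ne (by positivity) h.symm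
  positivity

theorem normε_pos (h : S.Xd u p ^ 2 + S.Yd u p ^ 2 ≠ 0) (ε : ℝ) : 0 < S.normε ε u p :=
  Real.sqrt_pos.2 (lt_of_le_of_ne (by positivity) (S.grad_sq_ne_zero h ε).symm)

theorem mdifferentiableAt_E₁Coeff (hu : ContMDiff (𝓡 3) 𝓘(ℝ, ℝ) 2 u)
    (h : S.Xd u p ^ 2 + S.Yd u p ^ 2 ≠ 0) (k : Fin 3) :
    MDifferentiableAt (𝓡 3) 𝓘(ℝ, ℝ) (S.E₁Coeff u k) p := by
  have hl := (S.normH_pos h).ne'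
  have hd := S.mdifferentiableAt_normH hu h
  fin_cases k
  · exact ((S.mdifferentiableAt_Yd hu).div hd hl).neg
  · exact (S.mdifferentiableAt_Xd hu).div hd hl
  · exact mdifferentiableAt_const

theorem mdifferentiableAt_E₂Coeff (hu : ContMDiff (𝓡 3) 𝓘(ℝ, ℝ) 2 u)
    (h : S.Xd u p ^ 2 + S.Yd u p ^ 2 ≠ 0) (ε : ℝ) (k : Fin 3) :
    MDifferentiableAt (𝓡 3) 𝓘(ℝ, ℝ) (S.E₂Coeff ε u k) p := by
  have hl := (S.normH_pos h).ne'
  have hd := S.mdifferentiableAt_normH hu h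
  have hq := hd.div (S.mdifferentiableAt_normε hu (S.grad_sq_ne_zero h ε)) (S.normε_pos h ε).ne'
  have ht := (S.mdifferentiableAt_gradCoeff (p := p) hu ε 2).div hd hl
  fin_cases k
  · exact hq.mul (ht.mul ((S.mdifferentiableAt_Xd hu).div hd hl))
  · exact hq.mul (ht.mul ((S.mdifferentiableAt_Yd hu).div hd hl))
  · exact hq.mul mdifferentiableAt_const

/-- Differentiating the factor `1 / l_ε` of the normal yields a multiple of the gradient, which is
orthogonal to the tangent field `w`. Hence only second derivatives of `u` and the connection terms
contribute. -/
theorem metric_nabla_normal (hu : ContMDiff (𝓡 3) 𝓘(ℝ, ℝ) 2 u)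
    (h : S.Xd u p ^ 2 + S.Yd u p ^ 2 ≠ 0) {ε : ℝ} (hε : ε ≠ 0) {v w : Fin 3 → G → ℝ}
    (hv : ∀ i, MDifferentiableAt (𝓡 3) 𝓘(ℝ, ℝ) (v i) p)
    (hw : ∑ k, w k p * S.gradCoeff ε u k p = 0) :
    S.metric ε p (S.nabla ε (S.comb ε v) (S.normal ε u) p) (S.comb ε w p) =
      ∑ k, w k p * ((S.normε ε u p)⁻¹ *
          (![1, 1, ε] k * ∑ i, v i p * (![1, 1, ε] i * S.frameHess u p i k))
        + S.conn ε (fun i => v i p) (fun i => S.gradCoeff ε u i p * (S.normε ε u p)⁻¹) k) := by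
  have hm : MDifferentiableAt (𝓡 3) 𝓘(ℝ, ℝ) (fun g => (S.normε ε u g)⁻¹) p :=
    (S.mdifferentiableAt_normε hu (S.grad_sq_ne_zero h ε)).inv (S.normε_pos h ε).ne'
  have hx := S.mdifferentiableAt_gradCoeff (p := p) hu ε
  have hn (k : Fin 3) : MDifferentiableAt (𝓡 3) 𝓘(ℝ, ℝ)
      (fun g => S.gradCoeff ε u k g * (S.normε ε u g)⁻¹) p := (hx k).mul hm
  rw [normal_eq_comb, S.nabla_comb hε hv hn, metric_eq_sum]
  simp only [S.coordε_comb hε, map_sum, map_smul, S.coordε_frameε hε, smul_eq_mul, mul_ite,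
    mul_one, mul_zero, Finset.sum_ite_eq', Finset.mem_univ, if_true]
  simp only [along_mul _ (hx _) hm]
  rw [← sub_eq_zero, ← Finset.sum_sub_distrib]
  rw [← mul_zero (along (S.comb ε v) (fun g => (S.normε ε u g)⁻¹) p), ← hw, Finset.mul_sum]
  refine Finset.sum_congr rfl fun k _ => ?_
  have ha : along (S.comb ε v) (S.gradCoeff ε u k) p =
      ![1, 1, ε] k * ∑ i, v i p * (![1, 1, ε] i * S.frameHess u p i k) := by
    rw [along_comb, Finset.mul_sum]
    refine Finset.sum_congr rfl fun i _ => ?_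
    rw [S.along_frameε_gradCoeff hu]
    ring
  rw [ha]
  ring

end SurfaceFields

/-! ### The four entries of the second fundamental form. -/

section SecondFundamentalForm

variable {G : Type*} [TopologicalSpace G] [ChartedSpace E3 G] [Group G] [LieGroup (𝓡 3) ∞ G]
  (S : ContactSR G) {u : G → ℝ} {p : G}

/-! ### Closed forms of the second fundamental form

Here `P`, `Q` are the coefficients of the horizontal normal, `A (P X + Q Y) + ε b T_ε` is the
unit normal, `μ` is the inverse of `‖∇_ε u‖` and `h` contains the second derivatives of `u`. -/

/-- The `(E₁, E₁)` entry of the second fundamental form. -/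
def secondFF₁₁ (h : Fin 3 → Fin 3 → ℝ) (P Q A b μ ε : ℝ) : ℝ :=
  -(μ * (-Q * (-Q * h 0 0 + P * h 1 0) + P * (-Q * h 0 1 + P * h 1 1)))
    - A * (S.a₃ * Q - S.b₃ * P)
    - ε ^ 2 * b * (S.a₁ * Q ^ 2 + S.b₂ * P ^ 2 - (S.b₁ + S.a₂) * P * Q)

/-- The bounded part of the `(E₁, E₂)` entry of the second fundamental form, divided by `-ε`. -/
def secondFF₁₂ (h : Fin 3 → Fin 3 → ℝ) (P Q A b μ : ℝ) : ℝ :=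
  μ * (b * P * (-Q * h 0 0 + P * h 1 0) + b * Q * (-Q * h 0 1 + P * h 1 1)
      - A * (-Q * h 0 2 + P * h 1 2))
    + P * Q * (S.b₂ - S.a₁) - (S.b₁ + S.a₂) / 2 * (Q ^ 2 - P ^ 2)

/-- The bounded part of the `(E₂, E₁)` entry of the second fundamental form, divided by `-ε`. -/
def secondFF₂₁ (h : Fin 3 → Fin 3 → ℝ) (P Q A b μ ε : ℝ) : ℝ :=
  μ * (-Q * (b * P * h 0 0 + b * Q * h 1 0 - A * h 2 0)
      + P * (b * P * h 0 1 + b * Q * h 1 1 - A * h 2 1))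
    - b * A * (S.a₃ * P + S.b₃ * Q)
    + ε ^ 2 * b ^ 2 * (P * Q * (S.b₂ - S.a₁) + (S.b₁ + S.a₂) / 2 * (P ^ 2 - Q ^ 2))
    - A ^ 2 * (S.a₂ - S.b₁) / 2 - S.c * b ^ 2

/-- The `(E₂, E₂)` entry of the second fundamental form, divided by `-ε²`. -/
def secondFF₂₂ (h : Fin 3 → Fin 3 → ℝ) (P Q A b μ : ℝ) : ℝ :=
  μ * (b * P * (b * P * h 0 0 + b * Q * h 1 0 - A * h 2 0)
      + b * Q * (b * P * h 0 1 + b * Q * h 1 1 - A * h 2 1)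
      - A * (b * P * h 0 2 + b * Q * h 1 2 - A * h 2 2))
    + b * (S.a₁ * P ^ 2 + S.b₂ * Q ^ 2 + (S.b₁ + S.a₂) * P * Q)

theorem horizontal_unit (h : S.Xd u p ^ 2 + S.Yd u p ^ 2 ≠ 0) :
    (S.Xd u p / S.normH u p) ^ 2 + (S.Yd u p / S.normH u p) ^ 2 = 1 := by
  have hl := (S.normH_pos h).ne'
  field_simp
  exact (S.normH_sq u p).symm

theorem normal_unit (h : S.Xd u p ^ 2 + S.Yd u p ^ 2 ≠ 0) (ε : ℝ) :
    (S.normH u p / S.normε ε u p) ^ 2 + ε ^ 2 * (S.Td u p / S.normε ε u p) ^ 2 = 1 := by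
  have hm := (S.normε_pos h ε).ne'
  have h1 := S.normε_sq ε u p
  have h2 := S.normH_sq u p
  field_simp
  linarith

theorem E₁Coeff_apply (u : G → ℝ) (p : G) : (fun i => S.E₁Coeff u i p) =
    ![-(S.Yd u p / S.normH u p), S.Xd u p / S.normH u p, 0] := rfl

theorem E₂Coeff_apply (h : S.Xd u p ^ 2 + S.Yd u p ^ 2 ≠ 0) (ε : ℝ) :
    (fun i => S.E₂Coeff ε u i p) =
      ![ε * (S.Td u p / S.normε ε u p) * (S.Xd u p / S.normH u p),
        ε * (S.Td u p / S.normε ε u p) * (S.Yd u p / S.normH u p),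
        -(S.normH u p / S.normε ε u p)] := by
  have hl := (S.normH_pos h).ne'
  have hm := (S.normε_pos h ε).ne'
  funext i
  fin_cases i <;> simp [E₂Coeff] <;> field_simp

theorem normalCoeff_apply (h : S.Xd u p ^ 2 + S.Yd u p ^ 2 ≠ 0) (ε : ℝ) :
    (fun i => S.gradCoeff ε u i p * (S.normε ε u p)⁻¹) =
      ![S.normH u p / S.normε ε u p * (S.Xd u p / S.normH u p),
        S.normH u p / S.normε ε u p * (S.Yd u p / S.normH u p),
        ε * (S.Td u p / S.normε ε u p)] := by
  have hl := (S.normH_pos h).ne'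
  have hm := (S.normε_pos h ε).ne'
  funext i
  fin_cases i <;> simp [gradCoeff] <;> field_simp

theorem E₁Coeff_orthogonal (u : G → ℝ) (p : G) (ε : ℝ) :
    ∑ k, S.E₁Coeff u k p * S.gradCoeff ε u k p = 0 := by
  simp [Fin.sum_univ_three, E₁Coeff, gradCoeff]
  ring

theorem E₂Coeff_orthogonal (h : S.Xd u p ^ 2 + S.Yd u p ^ 2 ≠ 0) (ε : ℝ) :
    ∑ k, S.E₂Coeff ε u k p * S.gradCoeff ε u k p = 0 := by
  have hl := (S.normH_pos h).ne'
  have hm := (S.normε_pos h ε).ne'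
  have h2 := S.normH_sq u p
  simp [Fin.sum_univ_three, E₂Coeff, gradCoeff]
  field_simp
  rw [h2]
  ring

theorem secondFF_zero_zero (hu : ContMDiff (𝓡 3) 𝓘(ℝ, ℝ) 2 u)
    (h : S.Xd u p ^ 2 + S.Yd u p ^ 2 ≠ 0) {ε : ℝ} (hε : ε ≠ 0) :
    S.secondFF ε u p 0 0 = S.secondFF₁₁ (S.frameHess u p) (S.Xd u p / S.normH u p)
      (S.Yd u p / S.normH u p) (S.normH u p / S.normε ε u p) (S.Td u p / S.normε ε u p)
      (S.normε ε u p)⁻¹ ε := by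
  change -S.metric ε p (S.nabla ε (S.E₁ u) (S.normal ε u) p) (S.E₁ u p) = _
  have hv (i : Fin 3) := congrFun (S.E₁Coeff_apply u p) i
  rw [S.E₁_eq_comb ε, S.metric_nabla_normal hu h hε (S.mdifferentiableAt_E₁Coeff hu h)
      (S.E₁Coeff_orthogonal u p ε),
    S.E₁Coeff_apply u p, S.normalCoeff_apply h]
  simp only [hv, S.conn_eq hε, Fin.sum_univ_three, secondFF₁₁]
  have hpq := S.horizontal_unit h
  generalize S.Xd u p / S.normH u p = P at *
  generalize S.Yd u p / S.normH u p = Q at *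
  generalize S.normH u p / S.normε ε u p = A at *
  generalize S.Td u p / S.normε ε u p = b at *
  generalize S.c / ε = κ at *
  simp only [Fin.isValue, Matrix.cons_val_zero, Matrix.cons_val_one, Matrix.cons_val]
  linear_combination (-(A * S.a₃ * Q - A * S.b₃ * P)) * hpq

/-- The vertical and horizontal parts of `E₂` pair with the `c / ε` terms of the connection to give
`A² c / (2ε)` and `ε² b² c / (2ε)`; by `A² + ε² b² = 1` they sum to `c / (2ε)`. -/
theorem secondFF_zero_one (hu : ContMDiff (𝓡 3) 𝓘(ℝ, ℝ) 2 u)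
    (h : S.Xd u p ^ 2 + S.Yd u p ^ 2 ≠ 0) {ε : ℝ} (hε : ε ≠ 0) :
    S.secondFF ε u p 0 1 = -(S.c / (2 * ε)) - ε * S.secondFF₁₂ (S.frameHess u p) (S.Xd u p / S.normH u p)
      (S.Yd u p / S.normH u p) (S.normH u p / S.normε ε u p) (S.Td u p / S.normε ε u p)
      (S.normε ε u p)⁻¹ := by
  change -S.metric ε p (S.nabla ε (S.E₁ u) (S.normal ε u) p) (S.E₂ ε u p) = _
  obtain ⟨κ, hκ⟩ : ∃ κ, S.c / ε = κ := ⟨_, rfl⟩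
  have hc : S.c = κ * ε := by rw [← hκ]; field_simp
  have hc2 : S.c / (2 * ε) = κ / 2 := by rw [← hκ]; field_simp
  have hv (i : Fin 3) := congrFun (S.E₁Coeff_apply u p) i
  have hw (i : Fin 3) := congrFun (S.E₂Coeff_apply h ε) i
  rw [S.E₁_eq_comb ε, S.E₂_eq_comb ε, S.metric_nabla_normal hu h hε (S.mdifferentiableAt_E₁Coeff hu h)
      (S.E₂Coeff_orthogonal h ε),
    S.E₁Coeff_apply u p, S.normalCoeff_apply h]
  simp only [hv, hw, S.conn_eq hε, Fin.sum_univ_three, secondFF₁₂]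
  have hpq := S.horizontal_unit h
  have hA := S.normal_unit h ε
  generalize S.Xd u p / S.normH u p = P at *
  generalize S.Yd u p / S.normH u p = Q at *
  generalize S.normH u p / S.normε ε u p = A at *
  generalize S.Td u p / S.normε ε u p = b at *
  simp only [hκ, hc2]
  simp only [Fin.isValue, Matrix.cons_val_zero, Matrix.cons_val_one, Matrix.cons_val]
  linear_combination -(ε * P * Q * (S.b₂ - S.a₁) + S.a₂ * ε * (P ^ 2 - Q ^ 2) / 2
      + S.b₁ * ε * (P ^ 2 - Q ^ 2) / 2 + κ * (P ^ 2 + Q ^ 2) / 2) * hA - κ / 2 * hpq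

/-- Here the two singular contributions have opposite signs: `(A² - ε² b²) c / (2ε) = c / (2ε) - ε c
b²`. This explains the last term of `secondFF₂₁`. -/
theorem secondFF_one_zero (hu : ContMDiff (𝓡 3) 𝓘(ℝ, ℝ) 2 u)
    (h : S.Xd u p ^ 2 + S.Yd u p ^ 2 ≠ 0) {ε : ℝ} (hε : ε ≠ 0) :
    S.secondFF ε u p 1 0 = -(S.c / (2 * ε)) - ε * S.secondFF₂₁ (S.frameHess u p) (S.Xd u p / S.normH u p)
      (S.Yd u p / S.normH u p) (S.normH u p / S.normε ε u p) (S.Td u p / S.normε ε u p)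
      (S.normε ε u p)⁻¹ ε := by
  change -S.metric ε p (S.nabla ε (S.E₂ ε u) (S.normal ε u) p) (S.E₁ u p) = _
  obtain ⟨κ, hκ⟩ : ∃ κ, S.c / ε = κ := ⟨_, rfl⟩
  have hc : S.c = κ * ε := by rw [← hκ]; field_simp
  have hc2 : S.c / (2 * ε) = κ / 2 := by rw [← hκ]; field_simp
  have hv (i : Fin 3) := congrFun (S.E₁Coeff_apply u p) i
  have hw (i : Fin 3) := congrFun (S.E₂Coeff_apply h ε) i
  rw [S.E₁_eq_comb ε, S.E₂_eq_comb ε, S.metric_nabla_normal hu h hε (S.mdifferentiableAt_E₂Coeff hu h ε)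
      (S.E₁Coeff_orthogonal u p ε),
    S.E₂Coeff_apply h ε, S.normalCoeff_apply h]
  simp only [hv, hw, S.conn_eq hε, Fin.sum_univ_three, secondFF₂₁]
  have hpq := S.horizontal_unit h
  have hA := S.normal_unit h ε
  generalize S.Xd u p / S.normH u p = P at *
  generalize S.Yd u p / S.normH u p = Q at *
  generalize S.normH u p / S.normε ε u p = A at *
  generalize S.Td u p / S.normε ε u p = b at *
  simp only [hκ, hc2]
  rw [hc]
  simp only [Fin.isValue, Matrix.cons_val_zero, Matrix.cons_val_one, Matrix.cons_val]
  linear_combination -((S.a₂ - S.b₁) * ε * (1 - P ^ 2 - Q ^ 2) / 2 + κ * (P ^ 2 + Q ^ 2) / 2) * hA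
    - (-(A * b * ε * (S.a₃ * P + S.b₃ * Q)) + (S.a₂ - S.b₁) * b ^ 2 * ε ^ 3 / 2
      - (S.a₂ - S.b₁) * ε / 2 - b ^ 2 * ε ^ 2 * κ + κ / 2) * hpq

theorem secondFF_one_one (hu : ContMDiff (𝓡 3) 𝓘(ℝ, ℝ) 2 u)
    (h : S.Xd u p ^ 2 + S.Yd u p ^ 2 ≠ 0) {ε : ℝ} (hε : ε ≠ 0) :
    S.secondFF ε u p 1 1 = -(ε ^ 2 * S.secondFF₂₂ (S.frameHess u p) (S.Xd u p / S.normH u p)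
      (S.Yd u p / S.normH u p) (S.normH u p / S.normε ε u p) (S.Td u p / S.normε ε u p)
      (S.normε ε u p)⁻¹) := by
  change -S.metric ε p (S.nabla ε (S.E₂ ε u) (S.normal ε u) p) (S.E₂ ε u p) = _
  have hw (i : Fin 3) := congrFun (S.E₂Coeff_apply h ε) i
  rw [S.E₂_eq_comb ε, S.metric_nabla_normal hu h hε (S.mdifferentiableAt_E₂Coeff hu h ε)
      (S.E₂Coeff_orthogonal h ε),
    S.E₂Coeff_apply h ε, S.normalCoeff_apply h]
  simp only [hw, S.conn_eq hε, Fin.sum_univ_three, secondFF₂₂]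
  have hpq := S.horizontal_unit h
  have hA := S.normal_unit h ε
  generalize S.Xd u p / S.normH u p = P at *
  generalize S.Yd u p / S.normH u p = Q at *
  generalize S.normH u p / S.normε ε u p = A at *
  generalize S.Td u p / S.normε ε u p = b at *
  generalize S.c / ε = κ at *
  simp only [Fin.isValue, Matrix.cons_val_zero, Matrix.cons_val_one, Matrix.cons_val]
  linear_combination -(b * ε ^ 2 * (S.a₁ * P ^ 2 + (S.a₂ + S.b₁) * P * Q + S.b₂ * Q ^ 2)) * hA

end SecondFundamentalForm

/-! ### Commutators of second derivatives, cancellation of singular terms, and the limits. -/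

section Limits

variable {G : Type*} [TopologicalSpace G] [ChartedSpace E3 G] [Group G] [LieGroup (𝓡 3) ∞ G]
  (S : ContactSR G) {u : G → ℝ} {p : G}

theorem frame_ne_zero (i : Fin 3) (g : G) : S.frame i g ≠ 0 := by
  rw [← basisAt_apply]
  exact (S.basisAt g).ne_zero i

theorem along_leftInv_lie (u : G → ℝ) (p : G) {v : GroupLieAlgebra (𝓡 3) G} (a b c : ℝ)
    (hv : v = a • S.X + b • S.Y + c • S.T) :
    along (leftInv v) u p = a * S.Xd u p + b * S.Yd u p + c * S.Td u p := by
  have h : leftInv v p = a • leftInv S.X p + b • leftInv S.Y p + c • leftInv S.T p := by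
    rw [hv, leftInv_add_apply, leftInv_add_apply, leftInv_smul_apply, leftInv_smul_apply,
      leftInv_smul_apply]
  rw [along, h, map_add, map_add, map_smul, map_smul, map_smul]
  rfl

theorem frameHess_comm_X_Y (hu : ContMDiff (𝓡 3) 𝓘(ℝ, ℝ) 2 u) :
    S.frameHess u p 0 1 - S.frameHess u p 1 0 =
      S.a₃ * S.Xd u p + S.b₃ * S.Yd u p + S.c * S.Td u p :=
  (along_leftInv_comm hu S.X S.Y S.T (S.frame_ne_zero 2 p)).trans
    (S.along_leftInv_lie u p _ _ _ S.lie_X_Y)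

theorem frameHess_comm_X_T (hu : ContMDiff (𝓡 3) 𝓘(ℝ, ℝ) 2 u) :
    S.frameHess u p 0 2 - S.frameHess u p 2 0 = S.a₁ * S.Xd u p + S.b₁ * S.Yd u p := by
  refine (along_leftInv_comm hu S.X S.T S.T (S.frame_ne_zero 2 p)).trans ?_
  rw [S.along_leftInv_lie u p S.a₁ S.b₁ 0 (by rw [S.lie_X_T, zero_smul, add_zero])]
  ring

theorem frameHess_comm_Y_T (hu : ContMDiff (𝓡 3) 𝓘(ℝ, ℝ) 2 u) :
    S.frameHess u p 1 2 - S.frameHess u p 2 1 = S.a₂ * S.Xd u p + S.b₂ * S.Yd u p := by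
  refine (along_leftInv_comm hu S.Y S.T S.T (S.frame_ne_zero 2 p)).trans ?_
  rw [S.along_leftInv_lie u p S.a₂ S.b₂ 0 (by rw [S.lie_Y_T, zero_smul, add_zero])]
  ring

theorem along_normH (V : VField G) (hu : ContMDiff (𝓡 3) 𝓘(ℝ, ℝ) 2 u)
    (h : S.Xd u p ^ 2 + S.Yd u p ^ 2 ≠ 0) :
    along V (S.normH u) p =
      (S.Xd u p * along V (S.Xd u) p + S.Yd u p * along V (S.Yd u) p) / S.normH u p := by
  have hx := S.mdifferentiableAt_Xd (p := p) hu
  have hy := S.mdifferentiableAt_Yd (p := p) hu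
  -- Squares are written as products so that the product rule `along_mul` applies.
  have hf : S.normH u = fun g => √(S.Xd u g * S.Xd u g + S.Yd u g * S.Yd u g) := by
    funext g
    simp only [normH, sq]
  have hl : √(S.Xd u p * S.Xd u p + S.Yd u p * S.Yd u p) = S.normH u p :=
    (congrFun hf p).symm
  have hl0 := (S.normH_pos h).ne'
  have hq : MDifferentiableAt (𝓡 3) 𝓘(ℝ, ℝ)
      (fun g => S.Xd u g * S.Xd u g + S.Yd u g * S.Yd u g) p := (hx.mul hx).add (hy.mul hy)
  conv_lhs => rw [hf]
  rw [along_comp (f := fun g => S.Xd u g * S.Xd u g + S.Yd u g * S.Yd u g) V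
    (Real.hasDerivAt_sqrt (by simpa only [sq] using h)) hq,
    along_add V (f := fun g => S.Xd u g * S.Xd u g) (h := fun g => S.Yd u g * S.Yd u g)
      (hx.mul hx) (hy.mul hy),
    along_mul V hx hx, along_mul V hy hy, hl]
  field_simp
  ring

theorem along_div_normH (V : VField G) (hu : ContMDiff (𝓡 3) 𝓘(ℝ, ℝ) 2 u)
    (h : S.Xd u p ^ 2 + S.Yd u p ^ 2 ≠ 0) {f : G → ℝ}
    (hf : MDifferentiableAt (𝓡 3) 𝓘(ℝ, ℝ) f p) :
    along V (fun g => f g / S.normH u g) p = along V f p / S.normH u p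
      - f p * (S.Xd u p * along V (S.Xd u) p + S.Yd u p * along V (S.Yd u) p)
        / S.normH u p ^ 3 := by
  have hl0 := (S.normH_pos h).ne'
  have hd := S.mdifferentiableAt_normH hu h
  simp only [div_eq_mul_inv (f _)]
  rw [along_mul V (h := fun g => (S.normH u g)⁻¹) hf (hd.inv hl0), along_comp V (hasDerivAt_inv hl0) hd, S.along_normH V hu h]
  field_simp
  ring

theorem along_E₁ (u : G → ℝ) (p : G) (f : G → ℝ) :
    along (S.E₁ u) f p = -(S.Yd u p / S.normH u p) * along (S.frame 0) f p
      + S.Xd u p / S.normH u p * along (S.frame 1) f p := by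
  rw [along, E₁, map_add, map_smul, map_smul]
  rfl

theorem meanCurv_eq (hu : ContMDiff (𝓡 3) 𝓘(ℝ, ℝ) 2 u)
    (h : S.Xd u p ^ 2 + S.Yd u p ^ 2 ≠ 0) {ε : ℝ} (hε : ε ≠ 0) :
    S.meanCurv ε u p =
      ε ^ 2 * S.secondFF₂₂ (S.frameHess u p) (S.Xd u p / S.normH u p)
        (S.Yd u p / S.normH u p) (S.normH u p * (S.normε ε u p)⁻¹)
        (S.Td u p * (S.normε ε u p)⁻¹) (S.normε ε u p)⁻¹
      - S.secondFF₁₁ (S.frameHess u p) (S.Xd u p / S.normH u p)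
        (S.Yd u p / S.normH u p) (S.normH u p * (S.normε ε u p)⁻¹)
        (S.Td u p * (S.normε ε u p)⁻¹) (S.normε ε u p)⁻¹ ε := by
  rw [meanCurv, Matrix.trace_fin_two, S.secondFF_zero_zero hu h hε, S.secondFF_one_one hu h hε]
  simp only [div_eq_mul_inv]
  ring

/-- The product of the off-diagonal entries `-c / (2ε) - ε f` and `-c / (2ε) - ε f'` is `c² / (4ε²)
+ c (f + f') / 2 + ε² f f'`. Its first term cancels the singular part of the sectional curvature. -/
theorem gaussCurv_eq (hu : ContMDiff (𝓡 3) 𝓘(ℝ, ℝ) 2 u)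
    (h : S.Xd u p ^ 2 + S.Yd u p ^ 2 ≠ 0) {ε : ℝ} (hε : ε ≠ 0) :
    S.gaussCurv ε u p =
      S.sectionalRest (S.Xd u p / S.normH u p) (S.Yd u p / S.normH u p)
        (S.normH u p * (S.normε ε u p)⁻¹) (S.Td u p * (S.normε ε u p)⁻¹) ε
      - ε ^ 2 * S.secondFF₁₁ (S.frameHess u p) (S.Xd u p / S.normH u p)
          (S.Yd u p / S.normH u p) (S.normH u p * (S.normε ε u p)⁻¹)
          (S.Td u p * (S.normε ε u p)⁻¹) (S.normε ε u p)⁻¹ ε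
        * S.secondFF₂₂ (S.frameHess u p) (S.Xd u p / S.normH u p)
          (S.Yd u p / S.normH u p) (S.normH u p * (S.normε ε u p)⁻¹)
          (S.Td u p * (S.normε ε u p)⁻¹) (S.normε ε u p)⁻¹
      - S.c / 2 * (S.secondFF₁₂ (S.frameHess u p) (S.Xd u p / S.normH u p)
          (S.Yd u p / S.normH u p) (S.normH u p * (S.normε ε u p)⁻¹)
          (S.Td u p * (S.normε ε u p)⁻¹) (S.normε ε u p)⁻¹
        + S.secondFF₂₁ (S.frameHess u p) (S.Xd u p / S.normH u p)
          (S.Yd u p / S.normH u p) (S.normH u p * (S.normε ε u p)⁻¹)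
          (S.Td u p * (S.normε ε u p)⁻¹) (S.normε ε u p)⁻¹ ε)
      - ε ^ 2 * S.secondFF₁₂ (S.frameHess u p) (S.Xd u p / S.normH u p)
          (S.Yd u p / S.normH u p) (S.normH u p * (S.normε ε u p)⁻¹)
          (S.Td u p * (S.normε ε u p)⁻¹) (S.normε ε u p)⁻¹
        * S.secondFF₂₁ (S.frameHess u p) (S.Xd u p / S.normH u p)
          (S.Yd u p / S.normH u p) (S.normH u p * (S.normε ε u p)⁻¹)
          (S.Td u p * (S.normε ε u p)⁻¹) (S.normε ε u p)⁻¹ ε := by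
  have hE₁ : (fun i => S.coordε ε i p (S.E₁ u p)) =
      ![-(S.Yd u p / S.normH u p), S.Xd u p / S.normH u p, 0] := by
    rw [S.E₁_eq_comb ε]
    simp only [S.coordε_comb hε]
    rfl
  have hE₂ : (fun i => S.coordε ε i p (S.E₂ ε u p)) =
      ![ε * (S.Td u p / S.normε ε u p) * (S.Xd u p / S.normH u p),
        ε * (S.Td u p / S.normε ε u p) * (S.Yd u p / S.normH u p),
        -(S.normH u p / S.normε ε u p)] := by
    rw [S.E₂_eq_comb ε, ← S.E₂Coeff_apply h]
    simp only [S.coordε_comb hε]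
  rw [gaussCurv, Matrix.det_fin_two, S.secondFF_zero_zero hu h hε, S.secondFF_one_one hu h hε,
    S.secondFF_zero_one hu h hε, S.secondFF_one_zero hu h hε,
    S.sectional_eq hε (S.horizontal_unit h) (S.normal_unit h ε) hE₁ hE₂]
  -- Quotients by `l_ε` become multiples of `l_ε⁻¹`, so that the result is visibly polynomial in `ε`
  -- and `l_ε⁻¹`.
  simp only [div_eq_mul_inv (S.normH u p), div_eq_mul_inv (S.Td u p)]
  generalize S.secondFF₁₁ _ _ _ _ _ _ _ = f11
  generalize S.secondFF₁₂ _ _ _ _ _ _ = f12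
  generalize S.secondFF₂₁ _ _ _ _ _ _ _ = f21
  generalize S.secondFF₂₂ _ _ _ _ _ _ = f22
  field_simp
  ring

/-- The closed forms of both curvatures depend on `ε` only through this pair, so continuity at its
limit is all that is needed. -/
theorem tendsto_inv_normε (h : S.Xd u p ^ 2 + S.Yd u p ^ 2 ≠ 0) :
    Tendsto (fun ε : ℝ => (ε, (S.normε ε u p)⁻¹)) (𝓝[>] 0) (𝓝 (0, (S.normH u p)⁻¹)) := by
  have hc : Continuous fun ε : ℝ => S.normε ε u p := by
    unfold normε
    fun_prop
  have ht := hc.tendsto 0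
  rw [← congrFun (S.normH_eq_normε u) p] at ht
  exact (tendsto_id.prodMk_nhds (ht.inv₀ (S.normH_pos h).ne')).mono_left nhdsWithin_le_nhds

theorem tendsto_meanCurv (hu : ContMDiff (𝓡 3) 𝓘(ℝ, ℝ) 2 u)
    (h : S.Xd u p ^ 2 + S.Yd u p ^ 2 ≠ 0) :
    Tendsto (fun ε : ℝ => S.meanCurv ε u p) (𝓝[>] 0)
      (𝓝 (S.Xd (fun g => S.Xd u g / S.normH u g) p + S.Yd (fun g => S.Yd u g / S.normH u g) p
        + (S.a₃ * S.Yd u p - S.b₃ * S.Xd u p) / S.normH u p)) := by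
  let F : ℝ × ℝ → ℝ := fun z =>
    z.1 ^ 2 * S.secondFF₂₂ (S.frameHess u p) (S.Xd u p / S.normH u p)
        (S.Yd u p / S.normH u p) (S.normH u p * z.2) (S.Td u p * z.2) z.2
      - S.secondFF₁₁ (S.frameHess u p) (S.Xd u p / S.normH u p)
        (S.Yd u p / S.normH u p) (S.normH u p * z.2) (S.Td u p * z.2) z.2 z.1
  have hF : Continuous F := by
    simp only [F, secondFF₂₂, secondFF₁₁]
    fun_prop
  have hlim := (hF.tendsto (0, (S.normH u p)⁻¹)).comp (S.tendsto_inv_normε h)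
  refine Tendsto.congr' ?_ (hlim.trans_eq ?_)
  · filter_upwards [self_mem_nhdsWithin] with ε hε
    exact (S.meanCurv_eq hu h (ne_of_gt hε)).symm
  · congr 1
    have hl := (S.normH_pos h).ne'
    have hXX : S.Xd (fun g => S.Xd u g / S.normH u g) p = _ :=
      S.along_div_normH (S.frame 0) hu h (S.mdifferentiableAt_Xd hu)
    have hYY : S.Yd (fun g => S.Yd u g / S.normH u g) p = _ :=
      S.along_div_normH (S.frame 1) hu h (S.mdifferentiableAt_Yd hu)
    have hpq := S.horizontal_unit h
    obtain ⟨P, hP⟩ : ∃ P, S.Xd u p / S.normH u p = P := ⟨_, rfl⟩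
    obtain ⟨Q, hQ⟩ : ∃ Q, S.Yd u p / S.normH u p = Q := ⟨_, rfl⟩
    have hx : S.Xd u p = S.normH u p * P := by rw [← hP]; field_simp
    have hy : S.Yd u p = S.normH u p * Q := by rw [← hQ]; field_simp
    rw [hXX, hYY]
    change F (0, (S.normH u p)⁻¹) =
      S.frameHess u p 0 0 / S.normH u p - S.Xd u p * (S.Xd u p * S.frameHess u p 0 0
          + S.Yd u p * S.frameHess u p 0 1) / S.normH u p ^ 3
        + (S.frameHess u p 1 1 / S.normH u p - S.Yd u p * (S.Xd u p * S.frameHess u p 1 0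
          + S.Yd u p * S.frameHess u p 1 1) / S.normH u p ^ 3)
        + (S.a₃ * S.Yd u p - S.b₃ * S.Xd u p) / S.normH u p
    simp only [F, secondFF₂₂, secondFF₁₁, hP, hQ]
    rw [hP, hQ] at hpq
    rw [hx, hy]
    field_simp
    -- The divergence formula produces `1 - P²` and `1 - Q²` where the second fundamental form has
    -- `Q²` and `P²`.
    linear_combination S.normH u p ^ 2 * (S.frameHess u p 0 0 + S.frameHess u p 1 1) * hpq

theorem tendsto_gaussCurv (hu : ContMDiff (𝓡 3) 𝓘(ℝ, ℝ) 2 u)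
    (h : S.Xd u p ^ 2 + S.Yd u p ^ 2 ≠ 0) :
    Tendsto (fun ε : ℝ => S.gaussCurv ε u p) (𝓝[>] 0)
      (𝓝 (along (S.E₁ u) (fun g => S.c * (S.Td u g / S.normH u g)) p
        - (S.c * (S.Td u p / S.normH u p)) ^ 2)) := by
  let F : ℝ × ℝ → ℝ := fun z =>
    S.sectionalRest (S.Xd u p / S.normH u p) (S.Yd u p / S.normH u p)
      (S.normH u p * z.2) (S.Td u p * z.2) z.1
      - z.1 ^ 2 * S.secondFF₁₁ (S.frameHess u p) (S.Xd u p / S.normH u p)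
          (S.Yd u p / S.normH u p) (S.normH u p * z.2) (S.Td u p * z.2) z.2 z.1
        * S.secondFF₂₂ (S.frameHess u p) (S.Xd u p / S.normH u p)
          (S.Yd u p / S.normH u p) (S.normH u p * z.2) (S.Td u p * z.2) z.2
      - S.c / 2 * (S.secondFF₁₂ (S.frameHess u p) (S.Xd u p / S.normH u p)
          (S.Yd u p / S.normH u p) (S.normH u p * z.2) (S.Td u p * z.2) z.2
        + S.secondFF₂₁ (S.frameHess u p) (S.Xd u p / S.normH u p)
          (S.Yd u p / S.normH u p) (S.normH u p * z.2) (S.Td u p * z.2) z.2 z.1)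
      - z.1 ^ 2 * S.secondFF₁₂ (S.frameHess u p) (S.Xd u p / S.normH u p)
          (S.Yd u p / S.normH u p) (S.normH u p * z.2) (S.Td u p * z.2) z.2
        * S.secondFF₂₁ (S.frameHess u p) (S.Xd u p / S.normH u p)
          (S.Yd u p / S.normH u p) (S.normH u p * z.2) (S.Td u p * z.2) z.2 z.1
  have hF : Continuous F := by
    simp only [F, secondFF₁₁, secondFF₁₂, secondFF₂₁, secondFF₂₂, sectionalRest]
    fun_prop
  have hlim := (hF.tendsto (0, (S.normH u p)⁻¹)).comp (S.tendsto_inv_normε h)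
  refine Tendsto.congr' ?_ (hlim.trans_eq ?_)
  · filter_upwards [self_mem_nhdsWithin] with ε hε
    exact (S.gaussCurv_eq hu h (ne_of_gt hε)).symm
  · congr 1
    have hl := (S.normH_pos h).ne'
    have hTd := S.mdifferentiableAt_Td (p := p) hu
    have hT (V : VField G) := S.along_div_normH V hu h hTd
    have hq : MDifferentiableAt (𝓡 3) 𝓘(ℝ, ℝ) (fun g => S.Td u g / S.normH u g) p :=
      hTd.div (S.mdifferentiableAt_normH hu h) hl
    have hpq := S.horizontal_unit h
    have c01 := S.frameHess_comm_X_Y (p := p) hu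
    have c02 := S.frameHess_comm_X_T (p := p) hu
    have c12 := S.frameHess_comm_Y_T (p := p) hu
    rw [along_mul (S.E₁ u) (f := fun _ => S.c) mdifferentiableAt_const hq, along_const, mul_zero,
      add_zero, along_E₁, hT, hT]
    obtain ⟨P, hP⟩ : ∃ P, S.Xd u p / S.normH u p = P := ⟨_, rfl⟩
    obtain ⟨Q, hQ⟩ : ∃ Q, S.Yd u p / S.normH u p = Q := ⟨_, rfl⟩
    have hx : S.Xd u p = S.normH u p * P := by rw [← hP]; field_simp
    have hy : S.Yd u p = S.normH u p * Q := by rw [← hQ]; field_simp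
    change F (0, (S.normH u p)⁻¹) =
      S.c * (-(S.Yd u p / S.normH u p) * (S.frameHess u p 0 2 / S.normH u p
            - S.Td u p * (S.Xd u p * S.frameHess u p 0 0
              + S.Yd u p * S.frameHess u p 0 1) / S.normH u p ^ 3)
          + S.Xd u p / S.normH u p * (S.frameHess u p 1 2 / S.normH u p
            - S.Td u p * (S.Xd u p * S.frameHess u p 1 0
              + S.Yd u p * S.frameHess u p 1 1) / S.normH u p ^ 3))
        - (S.c * (S.Td u p / S.normH u p)) ^ 2
    simp only [F, secondFF₁₁, secondFF₁₂, secondFF₂₁, secondFF₂₂, sectionalRest, hP, hQ, S.b₂_eq]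
    rw [hP, hQ] at hpq
    rw [S.b₂_eq] at c12
    rw [hx, hy] at c01 c02 c12 ⊢
    -- `secondFF₂₁` contains derivatives of `Xu` and `Yu` along `T`, while the target has
    -- derivatives of `Tu` along `X` and `Y`. Expressing every mixed derivative in one order lets
    -- the lower-order bracket terms cancel those of `sectionalRest`.
    have e01 : S.frameHess u p 0 1 = S.frameHess u p 1 0 + (S.a₃ * (S.normH u p * P)
      + S.b₃ * (S.normH u p * Q) + S.c * S.Td u p) := by linarith
    have e02 : S.frameHess u p 0 2 = S.frameHess u p 2 0 + (S.a₁ * (S.normH u p * P)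
      + S.b₁ * (S.normH u p * Q)) := by linarith
    have e12 : S.frameHess u p 1 2 = S.frameHess u p 2 1 + (S.a₂ * (S.normH u p * P)
      + -S.a₁ * (S.normH u p * Q)) := by linarith
    rw [e01, e02, e12]
    generalize S.normH u p = l at *
    field_simp
    linear_combination (-(8 * l ^ 2 * S.c ^ 2 * S.Td u p ^ 2
      + 8 * l ^ 3 * S.c * S.Td u p * (Q * S.b₃ + P * S.a₃)
      + 4 * l ^ 4 * S.c * (3 * S.a₂ + S.b₁))) * hpq

end Limits

end ContactSR

end SubRiem

end

theorem mainTheorem8 {G : Type*} [TopologicalSpace G] [ChartedSpace SubRiem.E3 G] [Group G]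
    [LieGroup (𝓡 3) ∞ G] [ConnectedSpace G] (S : SubRiem.ContactSR G)
    (u : G → ℝ) (hu : SubRiem.IsDefining u)
    (p : G) (hp : p ∈ SubRiem.zeroSurface u \ S.charSet u) :
    Tendsto (fun ε : ℝ => S.meanCurv ε u p) (𝓝[>] 0)
      (𝓝 (S.Xd (fun g => S.Xd u g / S.normH u g) p + S.Yd (fun g => S.Yd u g / S.normH u g) p
        + (S.a₃ * S.Yd u p - S.b₃ * S.Xd u p) / S.normH u p)) ∧
    Tendsto (fun ε : ℝ => S.gaussCurv ε u p) (𝓝[>] 0)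
      (𝓝 (SubRiem.along (S.E₁ u) (fun g => S.c * (S.Td u g / S.normH u g)) p
        - (S.c * (S.Td u p / S.normH u p)) ^ 2)) := by
  have h : S.Xd u p ^ 2 + S.Yd u p ^ 2 ≠ 0 := by
    intro h0
    refine hp.2 ⟨hp.1, ?_⟩
    have hx : S.Xd u p = 0 := by nlinarith [sq_nonneg (S.Xd u p), sq_nonneg (S.Yd u p)]
    have hy : S.Yd u p = 0 := by nlinarith [sq_nonneg (S.Xd u p), sq_nonneg (S.Yd u p)]
    rw [hx, hy]
  exact ⟨S.tendsto_meanCurv hu.contMDiff h, S.tendsto_gaussCurv hu.contMDiff h⟩
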